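/- Let $d\ge 2$, let $\{|z\rangle\}_{z=1}^{d}$ be an orthonormal basis of $\mathbb{C}^d$ (energy eigenstates) with real energies $E_1,\dots,E_d$, and fix two distinct labels $x\neq y$. Let $\rho,\sigma$ be density matrices on $\mathbb{C}^d$ with $\operatorname{supp}\rho=\operatorname{supp}\sigma=\operatorname{span}\{|x\rangle,|y\rangle\}$, and let $P=|x\rangle\langle x|+|y\rangle\langle y|$. Notation. For density matrices, $(\rho_1,\rho_2)\succ(\rho_1',\rho_2')$ means $\mathcal{T}(\rho_1,\rho_2)\supseteq\mathcal{T}(\rho_1',\rho_2')$, where $\mathcal{T}(\rho_1,\rho_2)=\{(\operatorname{Tr}[E\rho_2],\operatorname{Tr}[E\rho_1]) : 0\le E\le \mathbb{1}\}$. For positive semidefinite $A,B$, $D_{\max}(A\|B)=\log_2\inf\{t\ge 0: tB-A\ge 0\}\in[-\infty,\infty]$ (with $\inf\emptyset=\infty$, $\log_2 0=-\infty$, $\log_2\infty=\infty$), and $D_{\min}(A\|B)=-\log_2\operatorname{Tr}[\Pi_A B]$, where $\Pi_A$ is the orthogonal projector onto the support of $A$. (a) Non-zero temperature. Let $\gamma=\mathcal{Z}^{-1}\sum_{z}e^{-\beta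 E_z}|z\rangle\langle z|$ with $\mathcal{Z}=\sum_z e^{-\beta E_z}$, $\beta\in\mathbb{R}$. The following are equivalent: (i) there is a completely positive trace-preserving linear map $\Phi$ on $d\times d$ matrices with $\Phi(\gamma)=\gamma$ and $\Phi(\rho)=\sigma$; (ii) $(\rho,\gamma)\succ(\sigma,\gamma)$; (iii) $D_{\max}(\rho\|\gamma)\ge D_{\max}(\sigma\|\gamma)$ and $D_{\max}(P\gamma P\|\rho)\ge D_{\max}(P\gamma P\|\sigma)$. (b) Zero temperature. Let $\gamma$ be the zero-temperature Gibbs state, that is, the limit $\beta\to\infty$ of the state in (a): $\gamma=\frac1g\sum_{z\,:\,E_z=\min_w E_w}|z\rangle\langle z|$, with $g$ the number of terms in the sum. Then (i), (ii) and the following are equivalent: (iii') $D_{\max}(\rho\|\gamma)\ge D_{\max}(\sigma\|\gamma)$, $D_{\max}(P\gamma P\|\rho)\ge D_{\max}(P\gamma P\|\sigma)$ and $D_{\min}(\gamma\|\rho)\ge D_{\min}(\gamma\|\sigma)$. (If $d=2$, then $P=\mathbb{1}$ and $P\gamma P=\gamma$.) -/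

import Mathlib

open scoped NNReal ENNReal ComplexOrder MatrixOrder Matrix.Norms.L2Operator CStarAlgebra

namespace QuantumLorenz

noncomputable section

/-- Operators on `ℂ^d`. The order `≤` on them is the Loewner order. -/
abbrev Op (d : ℕ) : Type := Matrix (Fin d) (Fin d) ℂ

/-- A density matrix: positive semidefinite with unit trace. -/
structure IsDensity {d : ℕ} (ρ : Op d) : Prop where
  posSemidef : ρ.PosSemidef
  trace_eq_one : ρ.trace = 1

/-- The support of a Hermitian operator, i.e. its range. -/
def supp {d : ℕ} (A : Op d) : Submodule ℂ (EuclideanSpace ℂ (Fin d)) :=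
  LinearMap.range (Matrix.toEuclideanLin A)

/-- The orthogonal projector onto the support of an operator, as a matrix. -/
def suppProj {d : ℕ} (A : Op d) : Op d :=
  (Matrix.toEuclideanCLM (𝕜 := ℂ)).symm (supp A).starProjection

/-- The rank-one operator `|v⟩⟨v|`. -/
def ketBra {d : ℕ} (v : EuclideanSpace ℂ (Fin d)) : Op d :=
  Matrix.vecMulVec v.ofLp (star v.ofLp)

/-- The testing region of a pair `(ρ₁, ρ₂)`: the set of all points `(Tr[E ρ₂], Tr[E ρ₁])`, where
`0 ≤ E ≤ 1`. -/
def testingRegion {d : ℕ} (ρ₁ ρ₂ : Op d) : Set (ℝ × ℝ) :=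
  {p | ∃ E : Op d, 0 ≤ E ∧ E ≤ 1 ∧ p = ((E * ρ₂).trace.re, (E * ρ₁).trace.re)}

/-- Relative majorization `(ρ₁, ρ₂) ≻ (ρ₁', ρ₂')`. -/
def RelMajorizes {d d' : ℕ} (ρ₁ ρ₂ : Op d) (ρ₁' ρ₂' : Op d') : Prop :=
  testingRegion ρ₁' ρ₂' ⊆ testingRegion ρ₁ ρ₂

/-- `sup(A/B) = inf {t ≥ 0 : t B - A ≥ 0}` in `[0, ∞]`, for positive semidefinite `A`, `B`. -/
def supRatio {d : ℕ} (A B : Op d) : ℝ≥0∞ :=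
  ⨅ (t : ℝ≥0) (_ : A ≤ (t : ℝ) • B), (t : ℝ≥0∞)

/-- Base-two logarithm on `[0, ∞]`, with `log 0 = -∞` and `log ∞ = ∞`. -/
def elog₂ (x : ℝ≥0∞) : EReal :=
  ENNReal.log x / ((Real.log 2 : ℝ) : EReal)

/-- The max-relative entropy `D_max(A‖B) = log sup(A/B)`; it is `∞` if the support of `A` is not
contained in that of `B`. -/
def Dmax {d : ℕ} (A B : Op d) : EReal := elog₂ (supRatio A B)

/-- The min-relative entropy `D_min(A‖B) = -log Tr[Π_A B]`, with `Π_A` the projector onto the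
support of `A`. -/
def Dmin {d : ℕ} (A B : Op d) : EReal :=
  -elog₂ (ENNReal.ofReal (suppProj A * B).trace.re)

/-- `ρ` can be transformed into `σ` by a completely positive trace-preserving map that
preserves `γ`. -/
def ConvertibleByPreserving {d : ℕ} (γ ρ σ : Op d) : Prop :=
  ∃ Φ : Op d →CP Op d, (∀ X : Op d, (Φ X).trace = X.trace) ∧ Φ γ = γ ∧ Φ ρ = σ

/-- The Gibbs state at inverse temperature `β` of the Hamiltonian with orthonormal eigenbasis `b`
and energies `E`. -/
def gibbsState {d : ℕ} (b : OrthonormalBasis (Fin d) ℂ (EuclideanSpace ℂ (Fin d)))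
    (E : Fin d → ℝ) (β : ℝ) : Op d :=
  (∑ z, Real.exp (-β * E z))⁻¹ • ∑ z, Real.exp (-β * E z) • ketBra (b z)

open Classical in
/-- The labels of the energy eigenstates of minimal energy. -/
def groundLabels {d : ℕ} (E : Fin d → ℝ) : Finset (Fin d) :=
  Finset.univ.filter fun z => ∀ w, E z ≤ E w

/-- The zero-temperature Gibbs state, i.e. the limit `β → ∞` of `gibbsState b E β`: the uniform
mixture of the eigenstates of minimal energy. -/
def zeroTempGibbsState {d : ℕ} (b : OrthonormalBasis (Fin d) ℂ (EuclideanSpace ℂ (Fin d)))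
    (E : Fin d → ℝ) : Op d :=
  ((groundLabels E).card : ℝ)⁻¹ • ∑ z ∈ groundLabels E, ketBra (b z)

/-- The compression `P γ P` of an operator to the subspace spanned by two orthonormal vectors
`u`, `v`, where `P = |u⟩⟨u| + |v⟩⟨v|`. -/
def compress {d : ℕ} (u v : EuclideanSpace ℂ (Fin d)) (γ : Op d) : Op d :=
  (ketBra u + ketBra v) * γ * (ketBra u + ketBra v)

end

end QuantumLorenz

namespace QuantumLorenz

open Matrix

/-! A channel preserving `γ` pulls effects back to effects, which gives (i) ⇒ (ii). For (ii) ⇒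
(iii), each inequality between divergences says that an operator inequality for `ρ` implies the same
one for `σ`. Such an inequality can be tested on effects, and majorization replaces every effect for
`σ` by one for `ρ` with the same two expectations.

The substance is (iii) ⇒ (i). Since `γ` commutes with `P`, a channel on the plane of `x` and `y`
extends to the whole space, so the problem is two-dimensional. If `γ` is invertible there,
simultaneous diagonalization gives `γ = |g₀⟩⟨g₀| + |g₁⟩⟨g₁|` and `ρ = l₀|g₀⟩⟨g₀| + l₁|g₁⟩⟨g₁|`. A
channel does the job as soon as it sends `|g₀⟩⟨g₀|`, `|g₁⟩⟨g₁|` to the solution `S₁`, `S₂` of `S₁ +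
S₂ = γ`, `l₀S₁ + l₁S₂ = σ`. The two `Dmax` inequalities make `S₁` and `S₂` positive. Such a channel
exists when `|⟨g₀, g₁⟩|² ≤ Tr[S₁S₂]` and the traces match (`exists_kraus_of_overlap`); the overlap
condition is automatic, because in dimension two `Tr[S₁S₂] = |⟨g₀, g₁⟩|² + det S₁ + det S₂`
(`trace_mul_eq_of_add_eq`).

At zero temperature the compressed `γ` may also vanish, and then `σ` can be prepared outright, or
have rank one. In the latter case the same construction works with `S₁ = γ`, and the overlap
condition becomes the `Dmin` inequality. -/

theorem exists_eq_mul_conjTranspose {n : Type*} [Fintype n] [DecidableEq n] {A : Matrix n n ℂ}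
    (hA : A.PosSemidef) : ∃ B : Matrix n n ℂ, A = B * Bᴴ := by
  obtain ⟨B, hB⟩ := CStarAlgebra.nonneg_iff_eq_mul_star_self.mp hA.nonneg
  exact ⟨B, hB⟩

/-! ### Qubit channels with prescribed images of two pure states -/

theorem posSemidef_trace_sub {A : Matrix (Fin 2) (Fin 2) ℂ} (hA : A.PosSemidef) :
    (A.trace • (1 : Matrix (Fin 2) (Fin 2) ℂ) - A).PosSemidef := by
  -- In dimension two, `Tr[A] - A` is the adjugate of `A`, that is, `Aᵀ` conjugated by the rotation
  -- through a right angle.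
  have h := hA.transpose.conjTranspose_mul_mul_same !![0, 1; -1, 0]
  have e : A.trace • (1 : Matrix (Fin 2) (Fin 2) ℂ) - A =
      !![0, 1; -1, 0]ᴴ * Aᵀ * !![0, 1; -1, 0] := by
    ext i j
    fin_cases i <;> fin_cases j <;>
      simp [Matrix.mul_apply, Fin.sum_univ_two, Matrix.trace]
  rw [e]
  exact h

/-- The multiple `C = (c/τ) Gᴴ` has the right trace against `G`. It is a contraction because `Gᴴ G ≤
τ` and `|c|² ≤ τ`, and `D` is a square root of the defect `1 - C Cᴴ`. -/
theorem exists_contraction {G : Matrix (Fin 2) (Fin 2) ℂ} {c : ℂ}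
    (h : c * star c ≤ (Gᴴ * G).trace) :
    ∃ C D : Matrix (Fin 2) (Fin 2) ℂ, C * Cᴴ + D * Dᴴ = 1 ∧ (G * C).trace = c := by
  set τ := (Gᴴ * G).trace with hτ
  have hτ0 : 0 ≤ τ := (posSemidef_conjTranspose_mul_self G).trace_nonneg
  have hτs : star τ = τ := (Complex.nonneg_iff.mp hτ0) |>.2 |> fun h => by
    apply Complex.ext <;> simp [← h]
  rcases eq_or_ne τ 0 with h0 | h0
  · refine ⟨0, 1, by simp, ?_⟩
    rw [h0] at h
    have : c = 0 := by
      have h2 : c * star c = 0 := le_antisymm h (mul_star_self_nonneg c)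
      simpa using h2
    simp [this]
  · have hps : (1 - ((c / τ) • Gᴴ) * ((c / τ) • Gᴴ)ᴴ).PosSemidef := by
      have e : 1 - ((c / τ) • Gᴴ) * ((c / τ) • Gᴴ)ᴴ =
          (1 - c * star c / τ) • (1 : Matrix (Fin 2) (Fin 2) ℂ) +
          (c * star c / (τ * τ)) • (τ • (1 : Matrix (Fin 2) (Fin 2) ℂ) - Gᴴ * G) := by
        rw [conjTranspose_smul, conjTranspose_conjTranspose, smul_mul_smul_comm, star_div₀, hτs]
        have : c / τ * (star c / τ) = c * star c / (τ * τ) := by field_simp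
        rw [this, smul_sub, smul_smul, sub_smul, one_smul]
        have : c * star c / (τ * τ) * τ = c * star c / τ := by field_simp
        rw [this]; abel
      rw [e]
      have hτp : 0 < τ := lt_of_le_of_ne hτ0 h0.symm
      refine PosSemidef.add (PosSemidef.one.smul ?_) (PosSemidef.smul
        (posSemidef_trace_sub (posSemidef_conjTranspose_mul_self G)) ?_)
      · rw [sub_nonneg]
        exact (div_le_one hτp).mpr h
      · exact div_nonneg (mul_star_self_nonneg c) (mul_nonneg hτ0 hτ0)
    obtain ⟨D, hD⟩ := exists_eq_mul_conjTranspose hps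
    refine ⟨(c / τ) • Gᴴ, D, by rw [← hD]; abel, ?_⟩
    rw [Matrix.mul_smul, trace_smul, trace_mul_comm, ← hτ, smul_eq_mul]
    field_simp

/-- If the columns of `G` have at most the overlap of `S₁` and `S₂`, and the same traces, then
some channel maps their rank-one projectors to `S₁` and `S₂`. -/
theorem exists_kraus_of_overlap {G S₁ S₂ : Matrix (Fin 2) (Fin 2) ℂ} (hG : IsUnit G)
    (h₁ : S₁.PosSemidef) (h₂ : S₂.PosSemidef) (t₁ : S₁.trace = (Gᴴ * G) 0 0)
    (t₂ : S₂.trace = (Gᴴ * G) 1 1)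
    (h₁₂ : (Gᴴ * G) 0 1 * (Gᴴ * G) 1 0 ≤ (S₁ * S₂).trace) :
    ∃ K : Fin 2 ⊕ Fin 2 → Matrix (Fin 2) (Fin 2) ℂ, ∑ i, (K i)ᴴ * K i = 1 ∧
      ∀ a b : ℂ, ∑ i, K i * (G * diagonal ![a, b] * Gᴴ) * (K i)ᴴ = a • S₁ + b • S₂ := by
  obtain ⟨R₁, rfl⟩ := exists_eq_mul_conjTranspose h₁
  obtain ⟨R₂, rfl⟩ := exists_eq_mul_conjTranspose h₂
  have hH : (Gᴴ * G)ᴴ = Gᴴ * G := by simp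
  have h10 : (Gᴴ * G) 1 0 = star ((Gᴴ * G) 0 1) := by
    conv_lhs => rw [← hH]
    rfl
  obtain ⟨C, D, hCD, hC⟩ := exists_contraction (G := R₁ᴴ * R₂) (c := (Gᴴ * G) 0 1) (by
    rw [← h10]
    refine h₁₂.trans (le_of_eq ?_)
    rw [conjTranspose_mul, conjTranspose_conjTranspose, Matrix.mul_assoc, trace_mul_comm,
      trace_mul_comm (R₂ᴴ * R₁)]
    simp only [Matrix.mul_assoc])
  -- `X₁` and `X₂` are purifications of `S₁` and `S₂`. The contraction `C` tunes their overlap to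
  -- that of the columns of `G`, and the block with `D` keeps `X₂ * X₂ᴴ` equal to `S₂`.
  set X₁ : Matrix (Fin 2) (Fin 2 ⊕ Fin 2) ℂ := fromCols R₁ 0 with hX₁
  set X₂ : Matrix (Fin 2) (Fin 2 ⊕ Fin 2) ℂ := fromCols (R₂ * C) (R₂ * D) with hX₂
  let Y : Fin 2 ⊕ Fin 2 → Matrix (Fin 2) (Fin 2) ℂ := fun i => of fun a k => ![X₁ a i, X₂ a i] k
  have e₁ : X₁ * X₁ᴴ = R₁ * R₁ᴴ := by
    rw [hX₁, conjTranspose_fromCols_eq_fromRows_conjTranspose, fromCols_mul_fromRows]; simp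
  have e₂ : X₂ * X₂ᴴ = R₂ * R₂ᴴ := by
    rw [hX₂, conjTranspose_fromCols_eq_fromRows_conjTranspose, fromCols_mul_fromRows]
    rw [conjTranspose_mul, conjTranspose_mul]
    calc _ = R₂ * (C * Cᴴ + D * Dᴴ) * R₂ᴴ := by
          simp only [Matrix.mul_add, Matrix.add_mul, Matrix.mul_assoc]
      _ = _ := by rw [hCD, Matrix.mul_one]
  have e₁₂ : (X₁ᴴ * X₂).trace = (Gᴴ * G) 0 1 := by
    rw [← hC, hX₁, hX₂, conjTranspose_fromCols_eq_fromRows_conjTranspose, fromRows_mul_fromCols]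
    simp [Matrix.trace, Matrix.mul_assoc]
  have e₂₁ : (X₂ᴴ * X₁).trace = (Gᴴ * G) 1 0 := by
    rw [h10, ← e₁₂, ← trace_conjTranspose]; simp
  have f₁ : (X₁ᴴ * X₁).trace = (Gᴴ * G) 0 0 := by rw [trace_mul_comm, e₁, t₁]
  have f₂ : (X₂ᴴ * X₂).trace = (Gᴴ * G) 1 1 := by rw [trace_mul_comm, e₂, t₂]
  -- The purifications and the columns of `G` have the same Gram matrix, so an isometry carries the
  -- latter to the former; its blocks `Y i * G⁻¹` are the Kraus operators.
  have hYY : ∑ i, (Y i)ᴴ * Y i = Gᴴ * G := by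
    ext k l
    rw [Matrix.sum_apply]
    fin_cases k <;> fin_cases l
    · exact Eq.trans (by simp [Y, Matrix.trace, Matrix.mul_apply]) f₁
    · exact Eq.trans (by simp [Y, Matrix.trace, Matrix.mul_apply]) e₁₂
    · exact Eq.trans (by simp [Y, Matrix.trace, Matrix.mul_apply]) e₂₁
    · exact Eq.trans (by simp [Y, Matrix.trace, Matrix.mul_apply]) f₂
  have hGi : G⁻¹ * G = 1 := nonsing_inv_mul G ((isUnit_iff_isUnit_det G).mp hG)
  have hGi' : G * G⁻¹ = 1 := mul_nonsing_inv G ((isUnit_iff_isUnit_det G).mp hG)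
  refine ⟨fun i => Y i * G⁻¹, ?_, fun a b => ?_⟩
  · calc _ = G⁻¹ᴴ * (∑ i, (Y i)ᴴ * Y i) * G⁻¹ := by
          simp only [conjTranspose_mul, Finset.mul_sum, Finset.sum_mul, Matrix.mul_assoc]
      _ = (G * G⁻¹)ᴴ * (G * G⁻¹) := by rw [hYY, conjTranspose_mul]; simp only [Matrix.mul_assoc]
      _ = 1 := by rw [hGi']; simp
  · have : ∀ i, Y i * G⁻¹ * (G * diagonal ![a, b] * Gᴴ) * (Y i * G⁻¹)ᴴ =
        Y i * diagonal ![a, b] * (Y i)ᴴ := fun i => by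
      calc _ = Y i * (G⁻¹ * G) * diagonal ![a, b] * (G⁻¹ * G)ᴴ * (Y i)ᴴ := by
            simp only [conjTranspose_mul, Matrix.mul_assoc]
        _ = _ := by rw [hGi]; simp
    simp only [this]
    rw [← e₁, ← e₂]
    ext k l
    rw [Matrix.sum_apply]
    simp only [Y, Matrix.mul_apply, Matrix.add_apply, Matrix.smul_apply, Fin.sum_univ_two,
      Finset.mul_sum, smul_eq_mul, ← Finset.sum_add_distrib]
    refine Finset.sum_congr rfl fun i _ => ?_
    simp
    ring

/-! ### Convertibility of qubit states relative to a fixed operator -/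

/-- A channel in Kraus form that preserves `γ` maps `ρ` to `σ`. -/
def KrausConvertible {n : Type*} [Fintype n] [DecidableEq n] (γ ρ σ : Matrix n n ℂ) : Prop :=
  ∃ (ι : Type) (_ : Fintype ι) (K : ι → Matrix n n ℂ), ∑ i, (K i)ᴴ * K i = 1 ∧
    ∑ i, K i * γ * (K i)ᴴ = γ ∧ ∑ i, K i * ρ * (K i)ᴴ = σ

theorem KrausConvertible.refl {n : Type*} [Fintype n] [DecidableEq n] (γ ρ : Matrix n n ℂ) :
    KrausConvertible γ ρ ρ :=
  ⟨Unit, inferInstance, fun _ => 1, by simp, by simp, by simp⟩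

/-- With `γ = B Bᴴ`, a unitary `U` diagonalizes `B⁻¹ ρ B⁻¹ᴴ`, and `G = B U` serves both operators.
-/
theorem exists_simultaneous_diagonalization {n : Type*} [Fintype n] [DecidableEq n]
    {γ ρ : Matrix n n ℂ} (hγ : γ.PosDef) (hρ : ρ.PosDef) :
    ∃ (G : Matrix n n ℂ) (l : n → ℝ), IsUnit G ∧ (∀ i, 0 < l i) ∧ γ = G * Gᴴ ∧
      ρ = G * diagonal (fun i => (l i : ℂ)) * Gᴴ := by
  obtain ⟨B, rfl⟩ := exists_eq_mul_conjTranspose hγ.posSemidef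
  have hB : IsUnit B := isUnit_of_mul_isUnit_left hγ.isUnit
  have hBi : B * B⁻¹ = 1 := mul_nonsing_inv B ((isUnit_iff_isUnit_det B).mp hB)
  have hA : (B⁻¹ * ρ * (B⁻¹)ᴴ).PosDef :=
    (IsUnit.posDef_star_right_conjugate_iff (x := ρ)
      ((isUnit_nonsing_inv_iff).mpr hB)).mpr hρ
  set U : Matrix n n ℂ := (hA.1.eigenvectorUnitary : Matrix n n ℂ) with hU
  have hUU : U * Uᴴ = 1 := Unitary.coe_mul_star_self hA.1.eigenvectorUnitary
  refine ⟨B * U, hA.1.eigenvalues, hB.mul ((Unitary.isUnit_coe)), hA.eigenvalues_pos, ?_, ?_⟩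
  · calc B * Bᴴ = B * (U * Uᴴ) * Bᴴ := by rw [hUU, Matrix.mul_one]
      _ = _ := by simp only [conjTranspose_mul, Matrix.mul_assoc]
  · have hs : B⁻¹ * ρ * (B⁻¹)ᴴ = U * diagonal (fun i => (hA.1.eigenvalues i : ℂ)) * Uᴴ := by
      conv_lhs => rw [hA.1.spectral_theorem]
      rfl
    calc ρ = (B * B⁻¹) * ρ * (B * B⁻¹)ᴴ := by rw [hBi]; simp
      _ = B * (B⁻¹ * ρ * (B⁻¹)ᴴ) * Bᴴ := by simp only [conjTranspose_mul, Matrix.mul_assoc]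
      _ = B * (U * diagonal (fun i => (hA.1.eigenvalues i : ℂ)) * Uᴴ) * Bᴴ :=
          congrArg (fun M => B * M * Bᴴ) hs
      _ = _ := by simp only [conjTranspose_mul, Matrix.mul_assoc]

/-- Polarization of the determinant: `det (S₁ + S₂) = det S₁ + det S₂ + Tr S₁ Tr S₂ - Tr[S₁S₂]`,
while the left side equals `det (Gᴴ G)`. -/
theorem trace_mul_eq_of_add_eq {S₁ S₂ G : Matrix (Fin 2) (Fin 2) ℂ}
    (h : S₁ + S₂ = G * Gᴴ) (t₁ : S₁.trace = (Gᴴ * G) 0 0) (t₂ : S₂.trace = (Gᴴ * G) 1 1) :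
    (S₁ * S₂).trace = (Gᴴ * G) 0 1 * (Gᴴ * G) 1 0 + (S₁.det + S₂.det) := by
  have hd : (S₁ + S₂).det = (Gᴴ * G).det := by rw [h, det_mul, det_mul, mul_comm]
  simp only [det_fin_two, Matrix.add_apply, trace_fin_two, Matrix.mul_apply (M := S₁),
    Fin.sum_univ_two] at *
  linear_combination -hd + t₁ * (S₂ 0 0 + S₂ 1 1) + (Gᴴ * G) 0 0 * t₂

theorem krausConvertible_of_posDef {γ ρ σ : Matrix (Fin 2) (Fin 2) ℂ} (hγ : γ.PosDef)
    (hρ : ρ.PosDef) (ht : σ.trace = ρ.trace)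
    (h₁ : ∀ t : ℝ, 0 ≤ t → ρ ≤ t • γ → σ ≤ t • γ)
    (h₂ : ∀ t : ℝ, 0 ≤ t → γ ≤ t • ρ → γ ≤ t • σ) : KrausConvertible γ ρ σ := by
  obtain ⟨G, l, hG, hl, hγG, hρG⟩ := exists_simultaneous_diagonalization hγ hρ
  -- The numbers `l i` are the eigenvalues of `ρ` relative to `γ`; the hypotheses confine those of
  -- `σ` between the same extremes.
  have hup : ∀ t : ℝ, l 0 ≤ t → l 1 ≤ t → σ ≤ t • γ := by
    intro t h0 h1
    refine h₁ t ((hl 0).le.trans h0) ?_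
    rw [Matrix.le_iff]
    have : t • γ - ρ = G * diagonal (fun i => ((t - l i : ℝ) : ℂ)) * Gᴴ := by
      have e : diagonal (fun i => ((t - l i : ℝ) : ℂ)) =
          t • (1 : Matrix (Fin 2) (Fin 2) ℂ) - diagonal (fun i => (l i : ℂ)) := by
        ext i j; fin_cases i <;> fin_cases j <;> simp
      rw [e, Matrix.mul_sub, Matrix.sub_mul, ← hρG]
      simp [hγG]
    rw [this]
    refine (PosSemidef.diagonal fun i => ?_).mul_mul_conjTranspose_same G
    rw [Pi.zero_apply, ← Complex.ofReal_zero, Complex.real_le_real, sub_nonneg]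
    fin_cases i
    exacts [h0, h1]
  have hlo : ∀ m : ℝ, 0 < m → m ≤ l 0 → m ≤ l 1 → m • γ ≤ σ := by
    intro m hm h0 h1
    have : γ ≤ m⁻¹ • ρ := by
      rw [Matrix.le_iff]
      have : m⁻¹ • ρ - γ = G * diagonal (fun i => ((m⁻¹ * l i - 1 : ℝ) : ℂ)) * Gᴴ := by
        have e : diagonal (fun i => ((m⁻¹ * l i - 1 : ℝ) : ℂ)) =
            m⁻¹ • diagonal (fun i => (l i : ℂ)) - (1 : Matrix (Fin 2) (Fin 2) ℂ) := by
          ext i j; fin_cases i <;> fin_cases j <;> simp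
        rw [e, Matrix.mul_sub, Matrix.sub_mul, Matrix.mul_one, ← hγG, Matrix.mul_smul,
          Matrix.smul_mul, ← hρG]
      rw [this]
      refine (PosSemidef.diagonal fun i => ?_).mul_mul_conjTranspose_same G
      rw [Pi.zero_apply, ← Complex.ofReal_zero, Complex.real_le_real, sub_nonneg,
        ← div_eq_inv_mul, one_le_div hm]
      fin_cases i
      exacts [h0, h1]
    have h := smul_le_smul_of_nonneg_left (h₂ _ (inv_nonneg.mpr hm.le) this) hm.le
    rwa [smul_smul, mul_inv_cancel₀ hm.ne', one_smul] at h
  rcases eq_or_ne (l 0) (l 1) with he | hne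
  · have e1 : σ = l 0 • γ := le_antisymm (hup _ le_rfl he.ge) (hlo _ (hl 0) le_rfl he.le)
    have e2 : ρ = l 0 • γ := by
      have e : diagonal (fun i => (l i : ℂ)) = l 0 • (1 : Matrix (Fin 2) (Fin 2) ℂ) := by
        ext i j; fin_cases i <;> fin_cases j <;> simp [he]
      rw [hρG, e, hγG]; simp
    rw [e1, e2]
    exact KrausConvertible.refl _ _
  · set k : ℝ := l 0 - l 1 with hk
    have hk0 : k ≠ 0 := sub_ne_zero.mpr hne
    have hkc : (k : ℂ) ≠ 0 := by exact_mod_cast hk0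
    have hkk : (k : ℂ) = l 0 - l 1 := by rw [hk]; push_cast; rfl
    -- The operators `k⁻¹ • (σ - l 1 • γ)` and `k⁻¹ • (l 0 • γ - σ)` solve `S₁ + S₂ = γ`, `l₀S₁ +
    -- l₁S₂ = σ`. Either sign of `k` is possible, hence the case distinction.
    have p₁ : (k⁻¹ • (σ - l 1 • γ)).PosSemidef := by
      rw [← nonneg_iff_posSemidef]
      rcases lt_or_gt_of_ne hne with h | h
      · rw [← neg_smul_neg]
        refine smul_nonneg (by rw [neg_nonneg, inv_nonpos]; linarith) ?_
        rw [neg_sub, sub_nonneg]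
        exact hup _ h.le le_rfl
      · refine smul_nonneg (by rw [inv_nonneg]; linarith) ?_
        rw [sub_nonneg]
        exact hlo _ (hl 1) h.le le_rfl
    have p₂ : (k⁻¹ • (l 0 • γ - σ)).PosSemidef := by
      rw [← nonneg_iff_posSemidef]
      rcases lt_or_gt_of_ne hne with h | h
      · rw [← neg_smul_neg]
        refine smul_nonneg (by rw [neg_nonneg, inv_nonpos]; linarith) ?_
        rw [neg_sub, sub_nonneg]
        exact hlo _ (hl 0) le_rfl h.le
      · refine smul_nonneg (by rw [inv_nonneg]; linarith) ?_
        rw [sub_nonneg]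
        exact hup _ le_rfl h.le
    have tγ : γ.trace = (Gᴴ * G) 0 0 + (Gᴴ * G) 1 1 := by
      rw [hγG, trace_mul_comm, trace_fin_two]
    have tσ : σ.trace = l 0 * (Gᴴ * G) 0 0 + l 1 * (Gᴴ * G) 1 1 := by
      rw [ht, hρG, trace_mul_comm, ← Matrix.mul_assoc, trace_fin_two]
      simp [mul_comm]
    have t₁ : (k⁻¹ • (σ - l 1 • γ)).trace = (Gᴴ * G) 0 0 := by
      rw [trace_smul, trace_sub, trace_smul, tγ, tσ, Complex.real_smul, Complex.real_smul,
        Complex.ofReal_inv, inv_mul_eq_iff_eq_mul₀ hkc, hkk]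
      ring
    have t₂ : (k⁻¹ • (l 0 • γ - σ)).trace = (Gᴴ * G) 1 1 := by
      rw [trace_smul, trace_sub, trace_smul, tγ, tσ, Complex.real_smul, Complex.real_smul,
        Complex.ofReal_inv, inv_mul_eq_iff_eq_mul₀ hkc, hkk]
      ring
    have hsum : k⁻¹ • (σ - l 1 • γ) + k⁻¹ • (l 0 • γ - σ) = γ := by
      rw [← smul_add, sub_add_sub_comm, add_comm σ, add_sub_add_right_eq_sub, ← sub_smul,
        smul_smul, inv_mul_cancel₀ hk0, one_smul]
    obtain ⟨K, hK, hK'⟩ := exists_kraus_of_overlap hG p₁ p₂ t₁ t₂ (by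
      rw [trace_mul_eq_of_add_eq (hsum.trans hγG) t₁ t₂]
      exact le_add_of_nonneg_right (add_nonneg p₁.det_nonneg p₂.det_nonneg))
    refine ⟨_, inferInstance, K, hK, ?_, ?_⟩
    · have h := hK' 1 1
      have e : diagonal ![(1 : ℂ), 1] = 1 := by
        ext i j; fin_cases i <;> fin_cases j <;> simp
      rw [e, Matrix.mul_one, ← hγG, one_smul, one_smul, hsum] at h
      exact h
    · have h := hK' (l 0) (l 1)
      have e : diagonal ![(l 0 : ℂ), l 1] = diagonal (fun i => (l i : ℂ)) := by
        ext i j; fin_cases i <;> fin_cases j <;> simp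
      rw [e, ← hρG] at h
      rw [h]
      ext i j
      simp only [Matrix.add_apply, Matrix.smul_apply, Matrix.sub_apply, Complex.real_smul,
        smul_eq_mul, Complex.ofReal_inv]
      field_simp
      rw [hkk]
      ring

/-- With nothing to preserve, the input can be discarded and `σ = B Bᴴ` prepared, with Kraus
operators `B |i⟩⟨j|`. -/
theorem krausConvertible_zero {n : Type} [Fintype n] [DecidableEq n] {ρ σ : Matrix n n ℂ}
    (hσ : σ.PosSemidef) (hρt : ρ.trace = 1) (hσt : σ.trace = 1) :
    KrausConvertible 0 ρ σ := by
  obtain ⟨B, rfl⟩ := exists_eq_mul_conjTranspose hσ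
  refine ⟨n × n, inferInstance, fun p => B * single p.1 p.2 1, ?_, ?_, ?_⟩
  · rw [trace_mul_comm] at hσt
    have : ∀ p : n × n, (B * single p.1 p.2 (1 : ℂ))ᴴ * (B * single p.1 p.2 1) =
        single p.2 p.2 ((Bᴴ * B) p.1 p.1) := fun p => by
      rw [conjTranspose_mul, conjTranspose_single, Matrix.mul_assoc, ← Matrix.mul_assoc Bᴴ,
        ← Matrix.mul_assoc, single_mul_mul_single]
      simp
    simp only [this, Fintype.sum_prod_type_right]
    ext i j
    simp only [Matrix.sum_apply, single_apply]
    rcases eq_or_ne i j with rfl | h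
    · rw [Finset.sum_eq_single i (by intro b _ hb; simp [hb]) (by simp)]
      simpa [Matrix.trace] using hσt
    · rw [one_apply_ne h]
      refine Finset.sum_eq_zero fun k _ => Finset.sum_eq_zero fun l _ => if_neg ?_
      rintro ⟨rfl, rfl⟩
      exact h rfl
  · simp
  · have : ∀ p : n × n, B * single p.1 p.2 (1 : ℂ) * ρ * (B * single p.1 p.2 1)ᴴ =
        B * single p.1 p.1 (ρ p.2 p.2) * Bᴴ := fun p => by
      rw [conjTranspose_mul, conjTranspose_single, ← Matrix.mul_assoc, Matrix.mul_assoc B,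
        Matrix.mul_assoc B, single_mul_mul_single]
      simp
    simp only [this, ← Finset.sum_mul, ← Finset.mul_sum, Fintype.sum_prod_type]
    have : ∑ i : n, ∑ j : n, single i i (ρ j j) = 1 := by
      ext i j
      simp only [Matrix.sum_apply, single_apply]
      rcases eq_or_ne i j with rfl | h
      · rw [Finset.sum_eq_single i (by intro b _ hb; simp [hb]) (by simp)]
        simpa [Matrix.trace] using hρt
      · rw [one_apply_ne h]
        refine Finset.sum_eq_zero fun k _ => Finset.sum_eq_zero fun l _ => if_neg ?_
        rintro ⟨rfl, rfl⟩
        exact h rfl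
    rw [this, Matrix.mul_one]

/-- Here `ρ = mγ + |g⟩⟨g|` with `m` as large as possible. The channel is to fix `γ` and send
`|g⟩⟨g|` to `σ - mγ`, which `h₂` makes positive; the overlap condition reduces to `h₀`. -/
theorem krausConvertible_of_rankOne {c : ℝ} (hc : 0 < c) {ρ σ : Matrix (Fin 2) (Fin 2) ℂ}
    (hρ : ρ.PosDef) (ht : σ.trace = ρ.trace)
    (h₂ : ∀ t : ℝ, 0 ≤ t → diagonal ![(c : ℂ), 0] ≤ t • ρ → diagonal ![(c : ℂ), 0] ≤ t • σ)
    (h₀ : ρ 0 0 ≤ σ 0 0) : KrausConvertible (diagonal ![(c : ℂ), 0]) ρ σ := by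
  set z := ρ 0 1 with hz
  have h10 : ρ 1 0 = star z := (hρ.1.apply 1 0).symm
  obtain ⟨a, ha⟩ : ∃ a : ℝ, ρ 0 0 = a :=
    ⟨(ρ 0 0).re, (Complex.eq_re_of_ofReal_le (r := 0) (by simpa using hρ.diag_pos.le))⟩
  obtain ⟨b, hb⟩ : ∃ b : ℝ, ρ 1 1 = b :=
    ⟨(ρ 1 1).re, (Complex.eq_re_of_ofReal_le (r := 0) (by simpa using hρ.diag_pos.le))⟩
  have hb0 : 0 < b := by
    have : 0 < ρ 1 1 := hρ.diag_pos
    rw [hb] at this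
    exact_mod_cast this
  have hzz : z * star z = (Complex.normSq z : ℂ) := Complex.mul_conj z
  have hdet : 0 < a - Complex.normSq z / b := by
    have h := hρ.det_pos
    rw [det_fin_two, ha, hb, h10, ← hz, hzz] at h
    have h' : 0 < a * b - Complex.normSq z := by exact_mod_cast h
    rw [sub_pos, div_lt_iff₀ hb0]
    linarith
  obtain ⟨s, hs0, hs⟩ : ∃ s : ℝ, 0 < s ∧ c = s * s :=
    ⟨√c, Real.sqrt_pos.mpr hc, (Real.mul_self_sqrt hc.le).symm⟩
  obtain ⟨r, hr0, hr⟩ : ∃ r : ℝ, 0 < r ∧ b = r * r :=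
    ⟨√b, Real.sqrt_pos.mpr hb0, (Real.mul_self_sqrt hb0.le).symm⟩
  have hsc : (s : ℂ) ≠ 0 := by exact_mod_cast hs0.ne'
  have hrc : (r : ℂ) ≠ 0 := by exact_mod_cast hr0.ne'
  -- The Schur complement of the entry `b` in `ρ`, divided by `c`: subtracting `m` times `γ` makes
  -- `ρ` singular.
  obtain ⟨m, hm⟩ : ∃ m, m = (a - Complex.normSq z / b) / c := ⟨_, rfl⟩
  have hm0 : 0 < m := hm ▸ div_pos hdet hc
  have hmc : (m : ℂ) * c = a - z * star z / b := by
    rw [hzz]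
    have : m * c = a - Complex.normSq z / b := by rw [hm]; field_simp
    exact_mod_cast this
  set γ : Matrix (Fin 2) (Fin 2) ℂ := diagonal ![(c : ℂ), 0] with hγ
  set G : Matrix (Fin 2) (Fin 2) ℂ := !![(s : ℂ), z / r; 0, r] with hG
  have hcs : (c : ℂ) = s * s := by rw [hs]; push_cast; rfl
  have hbr : (b : ℂ) = r * r := by rw [hr]; push_cast; rfl
  have hGu : IsUnit G := by
    rw [isUnit_iff_isUnit_det, det_fin_two, isUnit_iff_ne_zero]
    simp [hG, hsc, hrc]
  have hGd : ∀ u v : ℂ, G * diagonal ![u, v] * Gᴴ =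
      !![u * c + v * (z * star z / b), v * z; v * star z, v * b] := fun u v => by
    ext i j
    fin_cases i <;> fin_cases j <;>
      simp [hG, Matrix.mul_apply, Fin.sum_univ_two, hcs, hbr, vecMul_diagonal] <;> field_simp
  have hGρ : G * diagonal ![(m : ℂ), 1] * Gᴴ = ρ := by
    rw [hGd, hmc]
    ext i j
    fin_cases i <;> fin_cases j <;> simp [ha, hb, h10, ← hz]
  have hGγ : G * diagonal ![1, 0] * Gᴴ = γ := by
    rw [hGd]
    ext i j
    fin_cases i <;> fin_cases j <;> simp [hγ]
  have hle : γ ≤ m⁻¹ • σ := by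
    refine h₂ _ (inv_nonneg.mpr hm0.le) ?_
    rw [Matrix.le_iff]
    have : m⁻¹ • ρ - γ = G * diagonal ![0, ((m⁻¹ : ℝ) : ℂ)] * Gᴴ := by
      rw [← hGρ, ← hGγ, ← Matrix.smul_mul, ← Matrix.mul_smul, ← Matrix.sub_mul, ← Matrix.mul_sub]
      congr 2
      ext i j
      fin_cases i <;> fin_cases j <;> simp [hm0.ne']
    rw [this]
    refine (PosSemidef.diagonal fun i => ?_).mul_mul_conjTranspose_same G
    fin_cases i
    · exact le_rfl
    · exact Complex.zero_le_real.mpr (inv_nonneg.mpr hm0.le)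
  have hS₂ : (σ - m • γ).PosSemidef := by
    have h := smul_le_smul_of_nonneg_left hle hm0.le
    rwa [smul_smul, mul_inv_cancel₀ hm0.ne', one_smul] at h
  have hS₁ : γ.PosSemidef := PosSemidef.diagonal fun i => by
    fin_cases i
    · exact Complex.zero_le_real.mpr hc.le
    · exact le_rfl
  have hH00 : (Gᴴ * G) 0 0 = c := by simp [hG, Matrix.mul_apply, Fin.sum_univ_two, hcs]
  have hH11 : (Gᴴ * G) 1 1 = z * star z / b + b := by
    simp [hG, Matrix.mul_apply, Fin.sum_univ_two, hbr]
    field_simp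
  have hH01 : (Gᴴ * G) 0 1 * (Gᴴ * G) 1 0 = c * (z * star z / b) := by
    simp [hG, Matrix.mul_apply, Fin.sum_univ_two, hcs, hbr]
    field_simp
  obtain ⟨K, hK, hK'⟩ := exists_kraus_of_overlap hGu hS₁ hS₂
    (by rw [hH00]; simp [hγ])
    (by
      rw [hH11, trace_sub, ht, trace_smul, trace_fin_two ρ, ha, hb]
      have : γ.trace = c := by simp [hγ]
      rw [this, Complex.real_smul, hmc]
      ring)
    (by
      have : (γ * (σ - m • γ)).trace = c * (σ 0 0 - m * c) := by
        simp [hγ, trace_fin_two]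
      rw [this, hH01, hmc]
      refine mul_le_mul_of_nonneg_left ?_ (Complex.zero_le_real.mpr hc.le)
      rw [ha] at h₀
      calc z * star z / b = a - (a - z * star z / b) := by ring
        _ ≤ _ := sub_le_sub_right h₀ _)
  refine ⟨_, inferInstance, K, hK, ?_, ?_⟩
  · rw [← hGγ, hK', hGγ, one_smul, zero_smul, add_zero]
  · rw [← hGρ, hK', one_smul, add_comm]
    exact sub_add_cancel _ _

/-! ### Positivity tested on effects -/

theorem trace_mul_re_nonneg {n : Type*} [Fintype n] [DecidableEq n] {A B : Matrix n n ℂ}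
    (hA : 0 ≤ A) (hB : 0 ≤ B) : 0 ≤ (A * B).trace.re := by
  obtain ⟨C, rfl⟩ := exists_eq_mul_conjTranspose (nonneg_iff_posSemidef.mp hB)
  rw [← Matrix.mul_assoc, trace_mul_comm, ← Matrix.mul_assoc]
  exact (Complex.nonneg_iff.mp
    ((nonneg_iff_posSemidef.mp hA).conjTranspose_mul_mul_same C).trace_nonneg).1

theorem nonneg_of_forall_effect {n : Type*} [Fintype n] [DecidableEq n] {A : Matrix n n ℂ}
    (hA : A.IsHermitian) (h : ∀ E : Matrix n n ℂ, 0 ≤ E → E ≤ 1 → 0 ≤ (E * A).trace.re) :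
    0 ≤ A := by
  refine (PosSemidef.of_dotProduct_mulVec_nonneg hA fun v => ?_).nonneg
  set R := vecMulVec v (star v) with hR
  have hR0 : 0 ≤ R := (posSemidef_vecMulVec_self_star v).nonneg
  -- Dividing by `‖R‖ + 1` turns `R` into an effect; the added one covers `v = 0`.
  have hc : 0 < ‖R‖ + 1 := by positivity
  have hR1 : R ≤ (‖R‖ + 1) • (1 : Matrix n n ℂ) := by
    have h1 : R ≤ ‖R‖ • (1 : Matrix n n ℂ) := by
      have := IsSelfAdjoint.le_algebraMap_norm_self (a := R) (IsSelfAdjoint.of_nonneg hR0)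
      rwa [Algebra.algebraMap_eq_smul_one] at this
    refine h1.trans ?_
    rw [add_smul, one_smul]
    exact le_add_of_nonneg_right PosSemidef.one.nonneg
  have h2 := h ((‖R‖ + 1)⁻¹ • R) (smul_nonneg (inv_nonneg.mpr hc.le) hR0) (by
    have := smul_le_smul_of_nonneg_left hR1 (inv_nonneg.mpr hc.le)
    rwa [smul_smul, inv_mul_cancel₀ hc.ne', one_smul] at this)
  have e : (R * A).trace = star v ⬝ᵥ A *ᵥ v := by
    rw [trace_mul_comm, hR, mul_vecMulVec, trace_vecMulVec, dotProduct_comm]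
  rw [Matrix.smul_mul, trace_smul, Complex.smul_re, smul_eq_mul, e] at h2
  rw [Complex.nonneg_iff]
  refine ⟨nonneg_of_mul_nonneg_right h2 (inv_pos.mpr hc), ?_⟩
  exact (hA.im_star_dotProduct_mulVec_self v).symm

/-! ### Completely positive maps and their action on testing regions -/

section Channels

variable {d : ℕ}

/-- The completely positive map with Kraus operators `K`. -/
noncomputable def krausMap {ι : Type*} [Fintype ι] (K : ι → Op d) : Op d →CP Op d where
  toFun X := ∑ i, K i * X * (K i)ᴴ
  map_add' X Y := by simp [Matrix.mul_add, Matrix.add_mul, Finset.sum_add_distrib]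
  map_smul' c X := by simp [Finset.smul_sum]
  map_cstarMatrix_nonneg' k M hM := by
    -- Amplified to block matrices, each Kraus term is conjugation by a block-diagonal matrix, which
    -- preserves positivity.
    let D : ι → CStarMatrix (Fin k) (Fin k) (Op d) := fun i =>
      CStarMatrix.ofMatrix (Matrix.diagonal fun _ => (K i)ᴴ)
    have e : M.map (fun X : Op d => ∑ i, K i * X * (K i)ᴴ) = ∑ i, star (D i) * M * D i := by
      ext1 a b
      have : ∀ i, (star (D i) * M * D i) a b = K i * M a b * (K i)ᴴ := fun i => by
        have hs : star (D i) = CStarMatrix.ofMatrix (Matrix.diagonal fun _ => K i) := by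
          ext1 a b
          rw [CStarMatrix.star_apply]
          simp only [D, CStarMatrix.ofMatrix_apply, Matrix.diagonal_apply]
          rcases eq_or_ne a b with rfl | hab
          · simp [star_eq_conjTranspose]
          · simp [hab, hab.symm]
        rw [hs]
        exact (Matrix.mul_diagonal _ _ a b).trans
          (congrArg (· * (K i)ᴴ) (Matrix.diagonal_mul _ _ a b))
      rw [CStarMatrix.map_apply]
      have hsum : (∑ i, star (D i) * M * D i) a b = ∑ i, (star (D i) * M * D i) a b :=
        Matrix.sum_apply a b Finset.univ (fun i => (star (D i) * M * D i : CStarMatrix _ _ _))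
      rw [hsum]
      simp only [this]
    change 0 ≤ M.map (fun X : Op d => ∑ i, K i * X * (K i)ᴴ)
    rw [e]
    exact Finset.sum_nonneg fun i _ => star_left_conjugate_nonneg hM _

theorem krausMap_apply {ι : Type*} [Fintype ι] (K : ι → Op d) (X : Op d) :
    krausMap K X = ∑ i, K i * X * (K i)ᴴ := rfl

theorem KrausConvertible.convertibleByPreserving {γ ρ σ : Op d} (h : KrausConvertible γ ρ σ) :
    ConvertibleByPreserving γ ρ σ := by
  obtain ⟨ι, _, K, hK, hγ, hρ⟩ := h
  refine ⟨krausMap K, fun X => ?_, hγ, hρ⟩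
  rw [krausMap_apply, trace_sum]
  calc ∑ i, (K i * X * (K i)ᴴ).trace = ((∑ i, (K i)ᴴ * K i) * X).trace := by
        rw [Finset.sum_mul, trace_sum]
        refine Finset.sum_congr rfl fun i _ => ?_
        rw [trace_mul_comm, ← Matrix.mul_assoc]
    _ = X.trace := by rw [hK, Matrix.one_mul]

/-- `F` is the image of `E` under the trace adjoint of `Φ`. Positivity of `Φ` gives `0 ≤ F`;
preservation of the trace makes `1 - F` the image of `1 - E`, so `F ≤ 1`. -/
theorem exists_dual_effect {Φ : Op d →ₗ[ℂ] Op d} (hpos : ∀ X, 0 ≤ X → 0 ≤ Φ X)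
    (htr : ∀ X, (Φ X).trace = X.trace) {E : Op d} (h0 : 0 ≤ E) (h1 : E ≤ 1) :
    ∃ F : Op d, 0 ≤ F ∧ F ≤ 1 ∧ ∀ X, (F * X).trace = (E * Φ X).trace := by
  let F : Op d := of fun i j => (E * Φ (single j i 1)).trace
  have hF : ∀ X, (F * X).trace = (E * Φ X).trace := fun X => by
    conv_rhs => rw [matrix_eq_sum_single X]
    simp only [map_sum, Finset.mul_sum, trace_sum]
    rw [Matrix.trace, Finset.sum_comm]
    refine Finset.sum_congr rfl fun i _ => ?_
    rw [diag_apply, Matrix.mul_apply]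
    refine Finset.sum_congr rfl fun j _ => ?_
    have : single j i (X j i) = X j i • single j i (1 : ℂ) := by simp
    rw [this, map_smul, Matrix.mul_smul, trace_smul, smul_eq_mul, mul_comm]
    rfl
  have key : ∀ G H : Op d, 0 ≤ H → (∀ X, (G * X).trace = (H * Φ X).trace) → 0 ≤ G := by
    intro G H hH hG
    have h2 : ∀ v : Fin d → ℂ, 0 ≤ star v ⬝ᵥ G *ᵥ v := fun v => by
      have e : (G * vecMulVec v (star v)).trace = star v ⬝ᵥ G *ᵥ v := by
        rw [mul_vecMulVec, trace_vecMulVec, dotProduct_comm]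
      rw [← e, hG]
      obtain ⟨C, hC⟩ := exists_eq_mul_conjTranspose (nonneg_iff_posSemidef.mp
        (hpos _ (posSemidef_vecMulVec_self_star v).nonneg))
      rw [hC, ← Matrix.mul_assoc, trace_mul_comm, ← Matrix.mul_assoc]
      exact ((nonneg_iff_posSemidef.mp hH).conjTranspose_mul_mul_same C).trace_nonneg
    refine (isPositive_toEuclideanLin_iff.mp ((LinearMap.isPositive_iff_complex _).mpr
      fun v => ?_)).nonneg
    have h3 : inner ℂ (toEuclideanLin G v) v = star (star v.ofLp ⬝ᵥ G *ᵥ v.ofLp) := by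
      rw [← inner_conj_symm]
      rw [EuclideanSpace.inner_eq_star_dotProduct, dotProduct_comm]
      rfl
    have h4 := Complex.nonneg_iff.mp (star_nonneg_iff.mpr (h2 v.ofLp))
    rw [h3]
    exact ⟨Complex.ext rfl h4.2, h4.1⟩
  refine ⟨F, key F E h0 hF, ?_, hF⟩
  rw [← sub_nonneg]
  refine key _ (1 - E) (sub_nonneg.mpr h1) fun X => ?_
  rw [Matrix.sub_mul, Matrix.sub_mul, trace_sub, trace_sub, hF, Matrix.one_mul, Matrix.one_mul,
    htr]

theorem ConvertibleByPreserving.relMajorizes {γ ρ σ : Op d} (h : ConvertibleByPreserving γ ρ σ) :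
    RelMajorizes ρ γ σ γ := by
  obtain ⟨Φ, htr, hγ, hρ⟩ := h
  rintro p ⟨E, h0, h1, rfl⟩
  obtain ⟨F, hF0, hF1, hF⟩ := exists_dual_effect (Φ := (Φ : Op d →ₗ[ℂ] Op d))
    (fun X hX => map_nonneg Φ hX) htr h0 h1
  refine ⟨F, hF0, hF1, ?_⟩
  rw [hF, hF]
  change _ = ((E * Φ γ).trace.re, (E * Φ ρ).trace.re)
  rw [hγ, hρ]

end Channels

/-! ### Divergence inequalities as implications between operator inequalities -/

section Divergences

variable {d : ℕ}

theorem elog₂_le_elog₂ {a b : ℝ≥0∞} : elog₂ a ≤ elog₂ b ↔ a ≤ b := by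
  have h : StrictMono elog₂ := by
    refine (EReal.strictMono_div_right_of_pos ?_ ?_).comp ENNReal.log_strictMono
    · exact_mod_cast Real.log_pos one_lt_two
    · exact EReal.coe_ne_top _
  exact h.le_iff_le

theorem supRatio_le_supRatio {A B A' B' : Op d} (hB' : 0 ≤ B') :
    supRatio A' B' ≤ supRatio A B ↔ ∀ t : ℝ, 0 ≤ t → A ≤ t • B → A' ≤ t • B' := by
  constructor
  · intro h t ht hAB
    lift t to ℝ≥0 using ht
    have h1 : supRatio A' B' ≤ t := h.trans (iInf₂_le t hAB)
    -- The infimum is reached: the inequality holds for every `s > t` and passes to the limit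
    -- because the positive cone is closed.
    have h2 : ∀ s : ℝ, (t : ℝ) < s → A' ≤ s • B' := fun s hs => by
      lift s to ℝ≥0 using t.2.trans hs.le
      have h3 : supRatio A' B' < s := h1.trans_lt (by exact_mod_cast hs)
      obtain ⟨r, hr⟩ := iInf_lt_iff.mp h3
      obtain ⟨hr1, hr2⟩ := iInf_lt_iff.mp hr
      exact hr1.trans (smul_le_smul_of_nonneg_right (by exact_mod_cast hr2.le) hB')
    have hlim : Filter.Tendsto (fun s : ℝ => s • B') (nhdsWithin (t : ℝ) (Set.Ioi t))
        (nhds ((t : ℝ) • B')) :=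
      ((continuous_id.smul continuous_const).tendsto (t : ℝ)).mono_left nhdsWithin_le_nhds
    exact ge_of_tendsto hlim (Filter.eventually_of_mem self_mem_nhdsWithin h2)
  · intro h
    exact le_iInf₂ fun t ht => iInf₂_le t (h t t.2 ht)

theorem dmax_ge_dmax {A B A' B' : Op d} (hB' : 0 ≤ B') :
    Dmax A B ≥ Dmax A' B' ↔ ∀ t : ℝ, 0 ≤ t → A ≤ t • B → A' ≤ t • B' :=
  elog₂_le_elog₂.trans (supRatio_le_supRatio hB')

theorem dmin_ge_dmin {γ ρ σ : Op d} (h : 0 ≤ (suppProj γ * σ).trace.re) :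
    Dmin γ ρ ≥ Dmin γ σ ↔ (suppProj γ * ρ).trace.re ≤ (suppProj γ * σ).trace.re := by
  rw [Dmin, Dmin, ge_iff_le, EReal.neg_le_neg_iff, elog₂_le_elog₂, ENNReal.ofReal_le_ofReal_iff h]

end Divergences

/-! ### Passage between a plane and the whole space -/

section Isometry

variable {m n : Type*} [Fintype m] [Fintype n]

theorem conjTranspose_mul_mul_mono {A B : Matrix n n ℂ} (h : A ≤ B) (J : Matrix n m ℂ) :
    Jᴴ * A * J ≤ Jᴴ * B * J := by
  rw [Matrix.le_iff, ← Matrix.sub_mul, ← Matrix.mul_sub]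
  exact (Matrix.le_iff.mp h).conjTranspose_mul_mul_same J

theorem mul_mul_conjTranspose_mono {A B : Matrix m m ℂ} (h : A ≤ B) (J : Matrix n m ℂ) :
    J * A * Jᴴ ≤ J * B * Jᴴ := by
  simpa using conjTranspose_mul_mul_mono h Jᴴ

variable [DecidableEq m] [DecidableEq n]

/-- A channel on a subspace extends by the identity on the orthogonal complement. -/
theorem KrausConvertible.of_isometry {J : Matrix n m ℂ} (hJ : Jᴴ * J = 1) {γ ρ σ : Matrix n n ℂ}
    (hγ : γ * (J * Jᴴ) = J * Jᴴ * γ) (hρ : J * Jᴴ * ρ * (J * Jᴴ) = ρ)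
    (hσ : J * Jᴴ * σ * (J * Jᴴ) = σ)
    (h : KrausConvertible (Jᴴ * γ * J) (Jᴴ * ρ * J) (Jᴴ * σ * J)) : KrausConvertible γ ρ σ := by
  obtain ⟨ι, _, K, hK, hKγ, hKρ⟩ := h
  set P := J * Jᴴ with hP
  have hPP : P * P = P := by
    calc P * P = J * (Jᴴ * J) * Jᴴ := by simp only [hP, Matrix.mul_assoc]
      _ = P := by rw [hJ, Matrix.mul_one]
  have hPh : Pᴴ = P := by simp [hP]
  have hlift : ∀ X : Matrix n n ℂ, ∑ i, J * K i * Jᴴ * X * (J * K i * Jᴴ)ᴴ =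
      J * (∑ i, K i * (Jᴴ * X * J) * (K i)ᴴ) * Jᴴ := fun X => by
    simp only [conjTranspose_mul, conjTranspose_conjTranspose, Matrix.mul_sum, Matrix.sum_mul,
      Matrix.mul_assoc]
  -- The extra Kraus operator `1 - P` acts as the identity on the complement. No coherences are
  -- lost, since `γ` is block diagonal and `ρ`, `σ` vanish off the range of `P`.
  refine ⟨Option ι, inferInstance, fun o => o.elim (1 - P) fun i => J * K i * Jᴴ, ?_, ?_, ?_⟩
  · rw [Fintype.sum_option]
    simp only [Option.elim]
    have : ∀ i, (J * K i * Jᴴ)ᴴ * (J * K i * Jᴴ) = J * ((K i)ᴴ * K i) * Jᴴ := fun i => by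
      calc _ = J * (K i)ᴴ * (Jᴴ * J) * K i * Jᴴ := by
            simp only [conjTranspose_mul, conjTranspose_conjTranspose, Matrix.mul_assoc]
        _ = _ := by rw [hJ]; simp only [Matrix.mul_assoc, Matrix.one_mul]
    simp only [this, ← Matrix.mul_sum, ← Matrix.sum_mul]
    rw [hK, Matrix.mul_one, ← hP, conjTranspose_sub, hPh, conjTranspose_one]
    simp [Matrix.mul_sub, Matrix.sub_mul, hPP]
  · rw [Fintype.sum_option]
    simp only [Option.elim]
    rw [hlift, hKγ, conjTranspose_sub, hPh, conjTranspose_one]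
    have e : J * (Jᴴ * γ * J) * Jᴴ = P * γ := by
      calc _ = P * γ * P := by simp only [hP, Matrix.mul_assoc]
        _ = _ := by rw [Matrix.mul_assoc, hγ, ← Matrix.mul_assoc, hPP]
    have e' : P * γ * P = P * γ := by rw [Matrix.mul_assoc, hγ, ← Matrix.mul_assoc, hPP]
    rw [e]
    simp [Matrix.mul_sub, Matrix.sub_mul, hγ, e']
  · rw [Fintype.sum_option]
    simp only [Option.elim]
    rw [hlift, hKρ]
    have e : J * (Jᴴ * σ * J) * Jᴴ = σ := by
      calc _ = P * σ * P := by simp only [hP, Matrix.mul_assoc]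
        _ = _ := hσ
    have e' : (1 - P) * ρ = 0 := by
      calc (1 - P) * ρ = (1 - P) * P * ρ * P := by
            conv_lhs => rw [← hρ]
            simp only [Matrix.mul_assoc]
        _ = 0 := by simp [Matrix.sub_mul, hPP]
    rw [e, e', Matrix.zero_mul, zero_add]

variable {J : Matrix n m ℂ} {γ ρ σ : Matrix n n ℂ}

theorem compression_le (hJ : Jᴴ * J = 1) (hγ0 : 0 ≤ γ) (hγ : γ * (J * Jᴴ) = J * Jᴴ * γ) :
    J * Jᴴ * γ * (J * Jᴴ) ≤ γ := by
  set P := J * Jᴴ with hP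
  have hPP : P * P = P := by
    calc P * P = J * (Jᴴ * J) * Jᴴ := by simp only [hP, Matrix.mul_assoc]
      _ = P := by rw [hJ, Matrix.mul_one]
  have hPh : Pᴴ = P := by simp [hP]
  have e : γ - P * γ * P = (1 - P)ᴴ * γ * (1 - P) := by
    have e' : P * γ * P = P * γ := by rw [Matrix.mul_assoc, hγ, ← Matrix.mul_assoc, hPP]
    rw [conjTranspose_sub, hPh, conjTranspose_one]
    simp [Matrix.mul_sub, Matrix.sub_mul, hγ, e']
  rw [Matrix.le_iff, e]
  exact (nonneg_iff_posSemidef.mp hγ0).conjTranspose_mul_mul_same _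

theorem upper_of_isometry (hJ : Jᴴ * J = 1) (hγ0 : 0 ≤ γ) (hγ : γ * (J * Jᴴ) = J * Jᴴ * γ)
    (hρ : J * Jᴴ * ρ * (J * Jᴴ) = ρ) (h : ∀ t : ℝ, 0 ≤ t → ρ ≤ t • γ → σ ≤ t • γ)
    (t : ℝ) (ht : 0 ≤ t) (hle : Jᴴ * ρ * J ≤ t • (Jᴴ * γ * J)) :
    Jᴴ * σ * J ≤ t • (Jᴴ * γ * J) := by
  have h1 := mul_mul_conjTranspose_mono hle J
  have h2 : ρ ≤ t • (J * Jᴴ * γ * (J * Jᴴ)) := by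
    rw [← hρ]
    simpa only [Matrix.mul_smul, Matrix.smul_mul, Matrix.mul_assoc] using h1
  have h3 := conjTranspose_mul_mul_mono
    (h t ht (h2.trans (smul_le_smul_of_nonneg_left (compression_le hJ hγ0 hγ) ht))) J
  simpa only [Matrix.mul_smul, Matrix.smul_mul] using h3

omit [DecidableEq n] in
theorem lower_of_isometry (hJ : Jᴴ * J = 1) (hρ : J * Jᴴ * ρ * (J * Jᴴ) = ρ)
    (h : ∀ t : ℝ, 0 ≤ t → J * Jᴴ * γ * (J * Jᴴ) ≤ t • ρ → J * Jᴴ * γ * (J * Jᴴ) ≤ t • σ)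
    (t : ℝ) (ht : 0 ≤ t) (hle : Jᴴ * γ * J ≤ t • (Jᴴ * ρ * J)) :
    Jᴴ * γ * J ≤ t • (Jᴴ * σ * J) := by
  have h1 := mul_mul_conjTranspose_mono hle J
  have h2 : J * Jᴴ * γ * (J * Jᴴ) ≤ t • ρ := by
    rw [← hρ]
    simpa only [Matrix.mul_smul, Matrix.smul_mul, Matrix.mul_assoc] using h1
  have h3 := conjTranspose_mul_mul_mono (h t ht h2) J
  have e : Jᴴ * (J * Jᴴ * γ * (J * Jᴴ)) * J = Jᴴ * γ * J := by
    calc _ = (Jᴴ * J) * (Jᴴ * γ * J) * (Jᴴ * J) := by simp only [Matrix.mul_assoc]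
      _ = _ := by rw [hJ, Matrix.one_mul, Matrix.mul_one]
  rwa [e, Matrix.mul_smul, Matrix.smul_mul] at h3

end Isometry

/-! ### Necessary conditions from relative majorization -/

section Majorization

variable {d : ℕ} {γ ρ σ : Op d}

theorem RelMajorizes.le_smul (h : RelMajorizes ρ γ σ γ) (hγ : γ.IsHermitian)
    (hσ : σ.IsHermitian) {t : ℝ} (hle : ρ ≤ t • γ) : σ ≤ t • γ := by
  rw [← sub_nonneg]
  refine nonneg_of_forall_effect ((hγ.smul (IsSelfAdjoint.all t)).sub hσ) fun E h0 h1 => ?_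
  obtain ⟨F, hF0, -, hF⟩ := h ⟨E, h0, h1, rfl⟩
  obtain ⟨e1, e2⟩ := Prod.mk.inj hF
  have := trace_mul_re_nonneg hF0 (sub_nonneg.mpr hle)
  simp only [Matrix.mul_sub, Matrix.mul_smul, trace_sub, trace_smul, Complex.sub_re,
    Complex.smul_re, e1, e2] at this ⊢
  exact this

theorem RelMajorizes.compression_le_smul {P : Op d} (hPh : P.IsHermitian) (hPP : P * P = P)
    (h : RelMajorizes ρ γ σ γ) (hγ : γ.PosSemidef) (hγP : γ * P = P * γ)
    (hσ : σ.IsHermitian) (hσP : P * σ * P = σ) {t : ℝ}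
    (hle : P * γ * P ≤ t • ρ) : P * γ * P ≤ t • σ := by
  have e' : P * γ * P = P * γ := by rw [Matrix.mul_assoc, hγP, ← Matrix.mul_assoc, hPP]
  have hQ : 0 ≤ γ - P * γ * P := by
    have e : γ - P * γ * P = (1 - P)ᴴ * γ * (1 - P) := by
      rw [conjTranspose_sub, hPh, conjTranspose_one]
      simp [Matrix.mul_sub, Matrix.sub_mul, hγP, e']
    rw [e]
    exact (hγ.conjTranspose_mul_mul_same _).nonneg
  have hPγ : (P * γ * P).IsHermitian := by
    have := isHermitian_conjTranspose_mul_mul P hγ.1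
    rwa [hPh] at this
  rw [← sub_nonneg]
  refine nonneg_of_forall_effect ((hσ.smul (IsSelfAdjoint.all t)).sub hPγ) fun R h0 h1 => ?_
  -- Adding `1 - P` to the test costs nothing on `σ` and collects all the weight of `γ` off the
  -- range of `P`. The effect `F` collects at most that much there, so its expectation on `P γ P` is
  -- at least that of `R`.
  have hE0 : 0 ≤ (1 - P) + P * R * P := by
    refine add_nonneg ?_ ?_
    · have := (posSemidef_conjTranspose_mul_self (1 - P)).nonneg
      rw [conjTranspose_sub, hPh, conjTranspose_one] at this
      simpa [Matrix.mul_sub, Matrix.sub_mul, hPP] using this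
    · have := conjTranspose_mul_mul_mono h0 P
      rw [hPh] at this
      simpa using this
  have hE1 : (1 - P) + P * R * P ≤ 1 := by
    have := conjTranspose_mul_mul_mono h1 P
    rw [hPh, Matrix.mul_one, hPP] at this
    calc (1 - P) + P * R * P ≤ (1 - P) + P := by gcongr
      _ = 1 := sub_add_cancel _ _
  obtain ⟨F, hF0, hF1, hF⟩ := h ⟨_, hE0, hE1, rfl⟩
  obtain ⟨e1, e2⟩ := Prod.mk.inj hF
  have k0 : (P * γ).trace = (P * γ * P).trace := by rw [e']
  have k1 : (P * R * P * γ).trace = (R * (P * γ * P)).trace := by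
    rw [Matrix.mul_assoc, Matrix.mul_assoc, trace_mul_comm]
    simp only [Matrix.mul_assoc]
  have k2 : (P * R * P * σ).trace = (R * σ).trace := by
    conv_rhs => rw [← hσP]
    rw [Matrix.mul_assoc, Matrix.mul_assoc, trace_mul_comm]
    simp only [Matrix.mul_assoc]
  have k3 : ((1 - P) * σ).trace = 0 := by
    rw [← hσP, Matrix.sub_mul, Matrix.one_mul, ← Matrix.mul_assoc, ← Matrix.mul_assoc, hPP,
      sub_self, trace_zero]
  have f1 := trace_mul_re_nonneg hF0 (sub_nonneg.mpr hle)
  have f2 := trace_mul_re_nonneg (sub_nonneg.mpr hF1) hQ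
  rw [Matrix.add_mul, trace_add, k1, Matrix.sub_mul, Matrix.one_mul, trace_sub, k0] at e1
  rw [Matrix.add_mul, trace_add, k2, k3, zero_add] at e2
  simp only [Matrix.mul_sub, Matrix.sub_mul, Matrix.one_mul, Matrix.mul_smul, trace_sub,
    trace_smul, Complex.sub_re, Complex.smul_re, Complex.add_re, smul_eq_mul] at *
  rw [e2]
  linarith

/-- Relative majorization with respect to a multiple of a projector does not decrease the weight
on that projector. -/
theorem RelMajorizes.trace_le {Q : Op d} {g : ℝ} (hQh : Q.IsHermitian) (hQQ : Q * Q = Q)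
    (hg : g ≠ 0) (hγ : γ = g • Q) (hρ : 0 ≤ ρ) (h : RelMajorizes ρ γ σ γ) :
    (Q * ρ).trace.re ≤ (Q * σ).trace.re := by
  have hQ0 : 0 ≤ Q := by
    have := (posSemidef_conjTranspose_mul_self Q).nonneg
    rwa [hQh, hQQ] at this
  have hQ1 : Q ≤ 1 := by
    have := (posSemidef_conjTranspose_mul_self (1 - Q)).nonneg
    rw [conjTranspose_sub, hQh, conjTranspose_one] at this
    rw [← sub_nonneg]
    simpa [Matrix.mul_sub, Matrix.sub_mul, hQQ] using this
  obtain ⟨F, hF0, hF1, hF⟩ := h ⟨Q, hQ0, hQ1, rfl⟩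
  obtain ⟨e1, e2⟩ := Prod.mk.inj hF
  rw [hγ, Matrix.mul_smul, Matrix.mul_smul, hQQ, trace_smul, trace_smul, Complex.smul_re,
    Complex.smul_re, smul_right_inj hg] at e1
  -- Equal expectations on `γ` mean `Tr[(1 - F) Q] = 0`; by positivity `(1 - F) Q = 0`, and so `Q ≤
  -- F`.
  obtain ⟨B, hB⟩ := exists_eq_mul_conjTranspose (Matrix.le_iff.mp hF1)
  have hBQ : Bᴴ * Q = 0 := by
    have hps := posSemidef_conjTranspose_mul_self (Bᴴ * Q)
    have ht : ((Bᴴ * Q)ᴴ * (Bᴴ * Q)).trace = ((1 - F) * Q).trace := by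
      rw [hB, conjTranspose_mul, conjTranspose_conjTranspose, hQh, Matrix.mul_assoc,
        trace_mul_comm, ← Matrix.mul_assoc, Matrix.mul_assoc _ Q Q, hQQ]
    rw [← trace_conjTranspose_mul_self_eq_zero_iff]
    have h0 := hps.trace_nonneg
    rw [Complex.nonneg_iff] at h0
    refine Complex.ext ?_ h0.2.symm
    rw [ht, Matrix.sub_mul, Matrix.one_mul, trace_sub, Complex.sub_re, e1, sub_self]
    rfl
  have hFQ : (1 - F) * Q = 0 := by rw [hB, Matrix.mul_assoc, hBQ, Matrix.mul_zero]
  have hQF : Q * (1 - F) = 0 := by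
    have := congrArg conjTranspose hFQ
    rwa [conjTranspose_mul, hQh, (Matrix.le_iff.mp hF1).1, conjTranspose_zero] at this
  have hle : Q ≤ F := by
    have h1 := conjTranspose_mul_mul_mono hF0 (1 - Q)
    rw [conjTranspose_sub, hQh, conjTranspose_one] at h1
    rw [Matrix.sub_mul, Matrix.one_mul, sub_eq_zero] at hFQ
    rw [Matrix.mul_sub, Matrix.mul_one, sub_eq_zero] at hQF
    rw [← sub_nonneg]
    simpa [Matrix.mul_sub, Matrix.sub_mul, ← hFQ, ← hQF, hQQ] using h1
  have h2 := trace_mul_re_nonneg (sub_nonneg.mpr hle) hρ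
  rw [Matrix.sub_mul, trace_sub, Complex.sub_re, ← e2] at h2
  linarith

end Majorization

/-! ### Operators diagonal in the energy basis, and compression to two levels -/

section Energy

variable {d : ℕ}

/-- The operator that is diagonal in the orthonormal basis `b` with eigenvalues `w`. -/
noncomputable def diagonalIn (b : OrthonormalBasis (Fin d) ℂ (EuclideanSpace ℂ (Fin d)))
    (w : Fin d → ℝ) : Op d := ∑ z, w z • ketBra (b z)

/-- The isometry whose columns are two basis vectors. -/
noncomputable def pairIsometry (b : OrthonormalBasis (Fin d) ℂ (EuclideanSpace ℂ (Fin d)))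
    (x y : Fin d) : Matrix (Fin d) (Fin 2) ℂ := of fun i k => (![b x, b y] k).ofLp i

variable (b : OrthonormalBasis (Fin d) ℂ (EuclideanSpace ℂ (Fin d))) {x y : Fin d}

theorem star_dotProduct_basis (z w : Fin d) :
    star (b z).ofLp ⬝ᵥ (b w).ofLp = if z = w then 1 else 0 := by
  rw [dotProduct_comm, ← EuclideanSpace.inner_eq_star_dotProduct]
  exact b.inner_eq_ite z w

theorem ketBra_mulVec (z w : Fin d) :
    ketBra (b z) *ᵥ (b w).ofLp = if z = w then (b z).ofLp else 0 := by
  rw [ketBra, vecMulVec_mulVec, star_dotProduct_basis]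
  split_ifs <;> simp

theorem ketBra_mul_ketBra (z w : Fin d) :
    ketBra (b z) * ketBra (b w) = if z = w then ketBra (b z) else 0 := by
  rw [ketBra, ketBra, vecMulVec_mul_vecMulVec, star_dotProduct_basis]
  split_ifs with h <;> simp [h]

theorem ketBra_isHermitian (v : EuclideanSpace ℂ (Fin d)) : (ketBra v).IsHermitian :=
  (posSemidef_vecMulVec_self_star _).1

theorem diagonalIn_mulVec (w : Fin d → ℝ) (z : Fin d) :
    diagonalIn b w *ᵥ (b z).ofLp = w z • (b z).ofLp := by
  rw [diagonalIn, sum_mulVec, Finset.sum_eq_single z]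
  · rw [smul_mulVec, ketBra_mulVec, if_pos rfl]
  · intro k _ hk
    rw [smul_mulVec, ketBra_mulVec, if_neg hk, smul_zero]
  · simp

theorem diagonalIn_mul (v w : Fin d → ℝ) :
    diagonalIn b v * diagonalIn b w = diagonalIn b (v * w) := by
  simp only [diagonalIn, Finset.sum_mul, Finset.mul_sum, Matrix.smul_mul, Matrix.mul_smul,
    ketBra_mul_ketBra]
  refine Finset.sum_congr rfl fun z _ => ?_
  simp [smul_smul, mul_comm]

theorem diagonalIn_posSemidef {w : Fin d → ℝ} (hw : 0 ≤ w) : (diagonalIn b w).PosSemidef :=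
  posSemidef_sum _ fun z _ => (posSemidef_vecMulVec_self_star _).smul (hw z)

theorem diagonalIn_isHermitian (w : Fin d → ℝ) : (diagonalIn b w).IsHermitian := by
  rw [IsHermitian, diagonalIn, conjTranspose_sum]
  exact Finset.sum_congr rfl fun z _ => (ketBra_isHermitian (b z)).smul (IsSelfAdjoint.all (w z))

theorem pairIsometry_isometry (hxy : x ≠ y) :
    (pairIsometry b x y)ᴴ * pairIsometry b x y = 1 := by
  have h : ∀ k l, ((pairIsometry b x y)ᴴ * pairIsometry b x y) k l =
      star (![b x, b y] k).ofLp ⬝ᵥ (![b x, b y] l).ofLp := fun k l => rfl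
  ext k l
  rw [h]
  fin_cases k <;> fin_cases l <;> simp [star_dotProduct_basis, hxy, hxy.symm]

theorem pairIsometry_mul_conjTranspose :
    pairIsometry b x y * (pairIsometry b x y)ᴴ = ketBra (b x) + ketBra (b y) := by
  ext i j
  simp [pairIsometry, Matrix.mul_apply, Fin.sum_univ_two, ketBra, vecMulVec_apply]

theorem pair_eq_diagonalIn (x y : Fin d) :
    ketBra (b x) + ketBra (b y) = diagonalIn b (Pi.single x 1 + Pi.single y 1) := by
  simp [diagonalIn, add_smul, Finset.sum_add_distrib, Pi.single_apply, ite_smul]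

theorem diagonalIn_commute (x y : Fin d) (w : Fin d → ℝ) :
    diagonalIn b w * (ketBra (b x) + ketBra (b y)) =
      (ketBra (b x) + ketBra (b y)) * diagonalIn b w := by
  rw [pair_eq_diagonalIn b x y, diagonalIn_mul, diagonalIn_mul, mul_comm]

theorem conjTranspose_pairIsometry_mul_mul (A : Op d) (k l : Fin 2) :
    ((pairIsometry b x y)ᴴ * A * pairIsometry b x y) k l =
      star (![b x, b y] k).ofLp ⬝ᵥ A *ᵥ (![b x, b y] l).ofLp := by
  rw [Matrix.mul_assoc]
  rfl

theorem compress_diagonalIn (hxy : x ≠ y) (w : Fin d → ℝ) :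
    (pairIsometry b x y)ᴴ * diagonalIn b w * pairIsometry b x y =
      diagonal ![(w x : ℂ), (w y : ℂ)] := by
  ext k l
  rw [conjTranspose_pairIsometry_mul_mul]
  fin_cases k <;> fin_cases l <;>
    simp [diagonalIn_mulVec, star_dotProduct_basis, hxy, hxy.symm]

variable {ρ σ : Op d}

theorem pair_mul_of_supp (hxy : x ≠ y) (hρ : ρ.IsHermitian)
    (h : supp ρ = Submodule.span ℂ {b x, b y}) :
    (ketBra (b x) + ketBra (b y)) * ρ * (ketBra (b x) + ketBra (b y)) = ρ := by
  set P := ketBra (b x) + ketBra (b y) with hP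
  have hPh : Pᴴ = P := (ketBra_isHermitian _).add (ketBra_isHermitian _)
  have hfix : ∀ v ∈ Submodule.span ℂ {b x, b y}, P *ᵥ v.ofLp = v.ofLp := by
    intro v hv
    induction hv using Submodule.span_induction with
    | mem v hv =>
      rcases hv with rfl | rfl
      · rw [hP, add_mulVec, ketBra_mulVec, ketBra_mulVec, if_pos rfl, if_neg hxy.symm, add_zero]
      · rw [hP, add_mulVec, ketBra_mulVec, ketBra_mulVec, if_pos rfl, if_neg hxy, zero_add]
    | zero => simp
    | add u v _ _ hu hv => rw [WithLp.ofLp_add, mulVec_add, hu, hv]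
    | smul c v _ hv => rw [WithLp.ofLp_smul, mulVec_smul, hv]
  have hPρ : P * ρ = ρ := by
    refine ext_of_mulVec_single fun i => ?_
    rw [← mulVec_mulVec]
    refine hfix (toEuclideanLin ρ (WithLp.toLp 2 (Pi.single i 1))) ?_
    rw [← h]
    exact LinearMap.mem_range_self _ _
  have hρP : ρ * P = ρ := by
    have := congrArg conjTranspose hPρ
    rwa [conjTranspose_mul, hPh, hρ] at this
  rw [hPρ, hρP]

/-- A vector killed by the compression lies, once embedded, in both the kernel and the range of the
Hermitian `ρ`; these are orthogonal. -/
theorem compress_posDef_of_supp (hxy : x ≠ y) (hρ : ρ.PosSemidef)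
    (h : supp ρ = Submodule.span ℂ {b x, b y}) :
    ((pairIsometry b x y)ᴴ * ρ * pairIsometry b x y).PosDef := by
  set J := pairIsometry b x y with hJ
  have hJJ : Jᴴ * J = 1 := pairIsometry_isometry b hxy
  have hP : J * Jᴴ * ρ * (J * Jᴴ) = ρ := by
    rw [pairIsometry_mul_conjTranspose]
    exact pair_mul_of_supp b hxy hρ.1 h
  rw [(hρ.conjTranspose_mul_mul_same J).posDef_iff_isUnit, ← mulVec_injective_iff_isUnit]
  rw [← coe_mulVecLin, ← LinearMap.ker_eq_bot, LinearMap.ker_eq_bot']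
  intro w hw
  rw [mulVecLin_apply] at hw
  have h1 : ρ *ᵥ (J *ᵥ w) = 0 := by
    have e : J * (Jᴴ * ρ * J) = ρ * J := by
      calc _ = J * Jᴴ * ρ * (J * (Jᴴ * J)) := by
            rw [hJJ]; simp only [Matrix.mul_assoc, Matrix.mul_one]
        _ = J * Jᴴ * ρ * (J * Jᴴ) * J := by simp only [Matrix.mul_assoc]
        _ = _ := by rw [hP]
    rw [mulVec_mulVec, ← e, ← mulVec_mulVec, hw, mulVec_zero]
  have hmem : WithLp.toLp 2 (J *ᵥ w) ∈ supp ρ := by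
    rw [h]
    have e : WithLp.toLp 2 (J *ᵥ w) = w 0 • b x + w 1 • b y := by
      ext i
      simp [hJ, pairIsometry, mulVec, dotProduct, Fin.sum_univ_two, mul_comm]
    rw [e]
    exact Submodule.add_mem _ (Submodule.smul_mem _ _ (Submodule.subset_span (by simp)))
      (Submodule.smul_mem _ _ (Submodule.subset_span (by simp)))
  obtain ⟨v, hv⟩ := hmem
  have hv' : ρ *ᵥ v.ofLp = J *ᵥ w := congrArg WithLp.ofLp hv
  have h2 : star (J *ᵥ w) ⬝ᵥ (J *ᵥ w) = 0 := by
    nth_rewrite 1 [← hv']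
    rw [star_mulVec, ← dotProduct_mulVec, hρ.1, h1, dotProduct_zero]
  have h3 : J *ᵥ w = 0 := dotProduct_star_self_eq_zero.mp h2
  have h4 : w = (Jᴴ * J) *ᵥ w := by rw [hJJ, one_mulVec]
  rw [h4, ← mulVec_mulVec, h3, mulVec_zero]

theorem compress_trace (hxy : x ≠ y) (hρ : ρ.IsHermitian)
    (h : supp ρ = Submodule.span ℂ {b x, b y}) :
    ((pairIsometry b x y)ᴴ * ρ * pairIsometry b x y).trace = ρ.trace := by
  conv_rhs => rw [← pair_mul_of_supp b hxy hρ h, ← pairIsometry_mul_conjTranspose]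
  rw [← Matrix.mul_assoc, trace_mul_comm _ (pairIsometry b x y)ᴴ]
  simp only [← Matrix.mul_assoc]
  rw [pairIsometry_isometry b hxy, Matrix.one_mul]

theorem suppProj_diagonalIn (w : Fin d → ℝ) :
    suppProj (diagonalIn b w) = diagonalIn b fun z => if w z = 0 then 0 else 1 := by
  have key : ∀ z, (supp (diagonalIn b w)).starProjection (b z) =
      (if w z = 0 then (0 : ℝ) else 1) • b z := fun z => by
    have hz : toEuclideanLin (diagonalIn b w) (b z) = w z • b z :=
      congrArg (WithLp.toLp 2) (diagonalIn_mulVec b w z)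
    split_ifs with h
    · rw [zero_smul, Submodule.starProjection_apply_eq_zero_iff, Submodule.mem_orthogonal]
      rintro _ ⟨v, rfl⟩
      have hs := isSymmetric_toEuclideanLin_iff.mpr (diagonalIn_isHermitian b w)
      rw [hs v (b z)]
      change inner ℂ v (toEuclideanLin (diagonalIn b w) (b z)) = 0
      rw [hz, h, zero_smul, inner_zero_right]
    · rw [one_smul, Submodule.starProjection_eq_self_iff]
      refine ⟨((w z)⁻¹ : ℝ) • b z, ?_⟩
      have : ((w z)⁻¹ : ℝ) • b z = (((w z)⁻¹ : ℝ) : ℂ) • b z := rfl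
      rw [this, map_smul, hz]
      change (w z)⁻¹ • w z • b z = b z
      rw [smul_smul, inv_mul_cancel₀ h, one_smul]
  refine (toEuclideanCLM (𝕜 := ℂ)).injective ?_
  refine ((toEuclideanCLM (𝕜 := ℂ)).apply_symm_apply _).trans ?_
  refine ContinuousLinearMap.coe_injective (b.toBasis.ext fun z => ?_)
  rw [b.coe_toBasis]
  refine (key z).trans ?_
  exact (congrArg (WithLp.toLp 2)
    (diagonalIn_mulVec b (fun z => if w z = 0 then 0 else 1) z)).symm

theorem gibbsState_eq_diagonalIn (E : Fin d → ℝ) (β : ℝ) : gibbsState b E β =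
    diagonalIn b fun z => (∑ z, Real.exp (-β * E z))⁻¹ * Real.exp (-β * E z) := by
  simp [gibbsState, diagonalIn, Finset.smul_sum, smul_smul]

open Classical in
theorem zeroTempGibbsState_eq_diagonalIn (E : Fin d → ℝ) : zeroTempGibbsState b E =
    diagonalIn b fun z => if z ∈ groundLabels E then ((groundLabels E).card : ℝ)⁻¹ else 0 := by
  simp [zeroTempGibbsState, diagonalIn, Finset.smul_sum, ite_smul]

end Energy

/-! ### The implications in each temperature regime -/

section Main

variable {d : ℕ} (b : OrthonormalBasis (Fin d) ℂ (EuclideanSpace ℂ (Fin d))) {x y : Fin d}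
  {ρ σ : Op d} {w : Fin d → ℝ}

theorem RelMajorizes.dmax_ge (hw : 0 ≤ w) (hxy : x ≠ y) (hσ : IsDensity σ)
    (hσs : supp σ = Submodule.span ℂ {b x, b y})
    (h : RelMajorizes ρ (diagonalIn b w) σ (diagonalIn b w)) :
    Dmax ρ (diagonalIn b w) ≥ Dmax σ (diagonalIn b w) ∧
      Dmax (compress (b x) (b y) (diagonalIn b w)) ρ ≥
        Dmax (compress (b x) (b y) (diagonalIn b w)) σ := by
  have hγ := diagonalIn_posSemidef b hw
  rw [dmax_ge_dmax hγ.nonneg, dmax_ge_dmax hσ.posSemidef.nonneg]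
  refine ⟨fun t _ hle => h.le_smul hγ.1 hσ.posSemidef.1 hle, fun t _ hle =>
    h.compression_le_smul ((ketBra_isHermitian _).add (ketBra_isHermitian _)) ?_ hγ
      (diagonalIn_commute b x y w) hσ.posSemidef.1
      (pair_mul_of_supp b hxy hσ.posSemidef.1 hσs) hle⟩
  simp [Matrix.add_mul, Matrix.mul_add, ketBra_mul_ketBra, hxy, hxy.symm]

theorem convertible_of_kraus_compress (hxy : x ≠ y) (hρ : IsDensity ρ) (hσ : IsDensity σ)
    (hρs : supp ρ = Submodule.span ℂ {b x, b y}) (hσs : supp σ = Submodule.span ℂ {b x, b y})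
    (h : KrausConvertible (diagonal ![(w x : ℂ), (w y : ℂ)])
      ((pairIsometry b x y)ᴴ * ρ * pairIsometry b x y)
      ((pairIsometry b x y)ᴴ * σ * pairIsometry b x y)) :
    ConvertibleByPreserving (diagonalIn b w) ρ σ := by
  rw [← compress_diagonalIn b hxy] at h
  refine (h.of_isometry (pairIsometry_isometry b hxy) ?_ ?_ ?_).convertibleByPreserving <;>
    rw [pairIsometry_mul_conjTranspose]
  · exact diagonalIn_commute b x y w
  · exact pair_mul_of_supp b hxy hρ.posSemidef.1 hρs
  · exact pair_mul_of_supp b hxy hσ.posSemidef.1 hσs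

theorem lower_compress (hxy : x ≠ y) (hρ : IsDensity ρ) (hσ : IsDensity σ)
    (hρs : supp ρ = Submodule.span ℂ {b x, b y})
    (h : Dmax (compress (b x) (b y) (diagonalIn b w)) ρ ≥
      Dmax (compress (b x) (b y) (diagonalIn b w)) σ) (t : ℝ) (ht : 0 ≤ t)
    (hle : diagonal ![(w x : ℂ), (w y : ℂ)] ≤
      t • ((pairIsometry b x y)ᴴ * ρ * pairIsometry b x y)) :
    diagonal ![(w x : ℂ), (w y : ℂ)] ≤
      t • ((pairIsometry b x y)ᴴ * σ * pairIsometry b x y) := by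
  rw [dmax_ge_dmax hσ.posSemidef.nonneg] at h
  rw [← compress_diagonalIn b hxy] at hle ⊢
  refine lower_of_isometry (pairIsometry_isometry b hxy) ?_ ?_ t ht hle <;>
    rw [pairIsometry_mul_conjTranspose]
  · exact pair_mul_of_supp b hxy hρ.posSemidef.1 hρs
  · exact h

theorem convertible_of_pos (hw : 0 ≤ w) (hxy : x ≠ y) (hρ : IsDensity ρ) (hσ : IsDensity σ)
    (hρs : supp ρ = Submodule.span ℂ {b x, b y}) (hσs : supp σ = Submodule.span ℂ {b x, b y})
    (hx : 0 < w x) (hy : 0 < w y) (h₁ : Dmax ρ (diagonalIn b w) ≥ Dmax σ (diagonalIn b w))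
    (h₂ : Dmax (compress (b x) (b y) (diagonalIn b w)) ρ ≥
      Dmax (compress (b x) (b y) (diagonalIn b w)) σ) :
    ConvertibleByPreserving (diagonalIn b w) ρ σ := by
  have hγ := diagonalIn_posSemidef b hw
  refine convertible_of_kraus_compress b hxy hρ hσ hρs hσs (krausConvertible_of_posDef ?_
    (compress_posDef_of_supp b hxy hρ.posSemidef hρs) ?_ ?_
    (lower_compress b hxy hρ hσ hρs h₂))
  · refine PosDef.diagonal fun i => ?_
    fin_cases i
    exacts [Complex.zero_lt_real.mpr hx, Complex.zero_lt_real.mpr hy]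
  · rw [compress_trace b hxy hσ.posSemidef.1 hσs, compress_trace b hxy hρ.posSemidef.1 hρs,
      hρ.trace_eq_one, hσ.trace_eq_one]
  · rw [dmax_ge_dmax hγ.nonneg] at h₁
    intro t ht hle
    rw [← compress_diagonalIn b hxy] at hle ⊢
    refine upper_of_isometry (pairIsometry_isometry b hxy) hγ.nonneg ?_ ?_ h₁ t ht hle <;>
      rw [pairIsometry_mul_conjTranspose]
    · exact diagonalIn_commute b x y w
    · exact pair_mul_of_supp b hxy hρ.posSemidef.1 hρs

theorem convertible_of_zero (hxy : x ≠ y) (hρ : IsDensity ρ) (hσ : IsDensity σ)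
    (hρs : supp ρ = Submodule.span ℂ {b x, b y}) (hσs : supp σ = Submodule.span ℂ {b x, b y})
    (hx : w x = 0) (hy : w y = 0) : ConvertibleByPreserving (diagonalIn b w) ρ σ := by
  refine convertible_of_kraus_compress b hxy hρ hσ hρs hσs ?_
  have e : diagonal ![(w x : ℂ), (w y : ℂ)] = 0 := by
    ext i j; fin_cases i <;> fin_cases j <;> simp [hx, hy]
  rw [e]
  refine krausConvertible_zero (hσ.posSemidef.conjTranspose_mul_mul_same _) ?_ ?_
  · rw [compress_trace b hxy hρ.posSemidef.1 hρs, hρ.trace_eq_one]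
  · rw [compress_trace b hxy hσ.posSemidef.1 hσs, hσ.trace_eq_one]

theorem trace_suppProj_mul (hxy : x ≠ y) (hρ : ρ.IsHermitian)
    (hρs : supp ρ = Submodule.span ℂ {b x, b y}) (hx : w x ≠ 0) (hy : w y = 0) :
    (suppProj (diagonalIn b w) * ρ).trace =
      ((pairIsometry b x y)ᴴ * ρ * pairIsometry b x y) 0 0 := by
  set J := pairIsometry b x y with hJ
  set Q := suppProj (diagonalIn b w) with hQ
  have e : Jᴴ * Q * J = diagonal ![1, 0] := by
    rw [hQ, suppProj_diagonalIn, hJ, compress_diagonalIn b hxy]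
    simp [hx, hy]
  calc (Q * ρ).trace = (Q * (J * Jᴴ * ρ * (J * Jᴴ))).trace := by
        rw [hJ, pairIsometry_mul_conjTranspose, pair_mul_of_supp b hxy hρ hρs]
    _ = ((Jᴴ * Q * J) * (Jᴴ * ρ * J)).trace := by
        simp only [← Matrix.mul_assoc]
        rw [trace_mul_comm]
        simp only [← Matrix.mul_assoc]
    _ = _ := by rw [e]; simp [trace_fin_two]

theorem trace_suppProj_mul_re_nonneg (hσ : 0 ≤ σ) :
    0 ≤ (suppProj (diagonalIn b w) * σ).trace.re := by
  rw [suppProj_diagonalIn]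
  refine trace_mul_re_nonneg (diagonalIn_posSemidef b fun z => ?_).nonneg hσ
  simp only [Pi.zero_apply]
  split_ifs <;> simp

theorem convertible_of_pos_of_zero (hxy : x ≠ y) (hρ : IsDensity ρ) (hσ : IsDensity σ)
    (hρs : supp ρ = Submodule.span ℂ {b x, b y}) (hσs : supp σ = Submodule.span ℂ {b x, b y})
    (hx : 0 < w x) (hy : w y = 0)
    (h₂ : Dmax (compress (b x) (b y) (diagonalIn b w)) ρ ≥
      Dmax (compress (b x) (b y) (diagonalIn b w)) σ)
    (h₃ : Dmin (diagonalIn b w) ρ ≥ Dmin (diagonalIn b w) σ) :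
    ConvertibleByPreserving (diagonalIn b w) ρ σ := by
  have hlow := lower_compress b hxy hρ hσ hρs h₂
  refine convertible_of_kraus_compress b hxy hρ hσ hρs hσs ?_
  rw [hy, Complex.ofReal_zero] at hlow ⊢
  refine krausConvertible_of_rankOne hx (compress_posDef_of_supp b hxy hρ.posSemidef hρs) ?_ hlow ?_
  · rw [compress_trace b hxy hσ.posSemidef.1 hσs, compress_trace b hxy hρ.posSemidef.1 hρs,
      hρ.trace_eq_one, hσ.trace_eq_one]
  · rw [dmin_ge_dmin (trace_suppProj_mul_re_nonneg b hσ.posSemidef.nonneg),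
      trace_suppProj_mul b hxy hρ.posSemidef.1 hρs hx.ne' hy,
      trace_suppProj_mul b hxy hσ.posSemidef.1 hσs hx.ne' hy] at h₃
    have k1 := Complex.nonneg_iff.mp
      (hρ.posSemidef.conjTranspose_mul_mul_same (pairIsometry b x y) |>.diag_nonneg (i := 0))
    have k2 := Complex.nonneg_iff.mp
      (hσ.posSemidef.conjTranspose_mul_mul_same (pairIsometry b x y) |>.diag_nonneg (i := 0))
    exact Complex.le_def.mpr ⟨h₃, k1.2.symm.trans k2.2⟩

theorem groundLabels_nonempty (E : Fin d → ℝ) (x : Fin d) : (groundLabels E).Nonempty := by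
  have : Nonempty (Fin d) := ⟨x⟩
  obtain ⟨z, hz⟩ := Finite.exists_min E
  exact ⟨z, by simpa [groundLabels] using hz⟩

end Main

end QuantumLorenz

open QuantumLorenz in
theorem theorem3 {d : ℕ} (b : OrthonormalBasis (Fin d) ℂ (EuclideanSpace ℂ (Fin d)))
    (E : Fin d → ℝ) (x y : Fin d) (hxy : x ≠ y) (ρ σ : Op d)
    (hρ : IsDensity ρ) (hσ : IsDensity σ)
    (hρ_supp : supp ρ = Submodule.span ℂ {b x, b y})
    (hσ_supp : supp σ = Submodule.span ℂ {b x, b y}) :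
    (∀ (β : ℝ) (γ : Op d), γ = gibbsState b E β →
      List.TFAE [
        ConvertibleByPreserving γ ρ σ,
        RelMajorizes ρ γ σ γ,
        Dmax ρ γ ≥ Dmax σ γ ∧
          Dmax (compress (b x) (b y) γ) ρ ≥ Dmax (compress (b x) (b y) γ) σ]) ∧
    (∀ γ : Op d, γ = zeroTempGibbsState b E →
      List.TFAE [
        ConvertibleByPreserving γ ρ σ,
        RelMajorizes ρ γ σ γ,
        Dmax ρ γ ≥ Dmax σ γ ∧
          Dmax (compress (b x) (b y) γ) ρ ≥ Dmax (compress (b x) (b y) γ) σ ∧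
          Dmin γ ρ ≥ Dmin γ σ]) := by
  classical
  constructor
  · rintro β γ rfl
    rw [gibbsState_eq_diagonalIn]
    have hZ : 0 < ∑ z, Real.exp (-β * E z) :=
      Finset.sum_pos (fun z _ => Real.exp_pos _) ⟨x, Finset.mem_univ x⟩
    have hpos : ∀ z, 0 < (∑ z, Real.exp (-β * E z))⁻¹ * Real.exp (-β * E z) := fun z =>
      mul_pos (inv_pos.mpr hZ) (Real.exp_pos _)
    tfae_have 1 → 2 := ConvertibleByPreserving.relMajorizes
    tfae_have 2 → 3 := RelMajorizes.dmax_ge b (fun z => (hpos z).le) hxy hσ hσ_supp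
    tfae_have 3 → 1 := fun h => convertible_of_pos b (fun z => (hpos z).le) hxy hρ hσ hρ_supp
      hσ_supp (hpos x) (hpos y) h.1 h.2
    tfae_finish
  · rintro γ rfl
    rw [zeroTempGibbsState_eq_diagonalIn]
    have hg : 0 < ((groundLabels E).card : ℝ)⁻¹ :=
      inv_pos.mpr (Nat.cast_pos.mpr (groundLabels_nonempty E x).card_pos)
    set w : Fin d → ℝ := fun z => if z ∈ groundLabels E then ((groundLabels E).card : ℝ)⁻¹ else 0
      with hwdef
    have hw : 0 ≤ w := fun z => by
      simp only [hwdef, Pi.zero_apply]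
      split_ifs
      exacts [hg.le, le_rfl]
    have hw' : ∀ z, w z = 0 ∨ 0 < w z := fun z => (hw z).eq_or_lt.imp_left Eq.symm
    -- All nonzero weights are equal at zero temperature, so `γ` is a multiple of its support
    -- projector, as `RelMajorizes.trace_le` requires.
    have hQ : ∀ A : Op d, A = suppProj (diagonalIn b w) → A.IsHermitian ∧ A * A = A ∧
        diagonalIn b w = ((groundLabels E).card : ℝ)⁻¹ • A := by
      rintro _ rfl
      rw [suppProj_diagonalIn]
      refine ⟨diagonalIn_isHermitian b _, ?_, ?_⟩
      · rw [diagonalIn_mul]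
        congr 1
        ext z
        simp
      · simp only [diagonalIn, Finset.smul_sum, smul_smul]
        refine Finset.sum_congr rfl fun z _ => ?_
        congr 1
        simp only [hwdef]
        split_ifs <;> simp_all
    tfae_have 1 → 2 := ConvertibleByPreserving.relMajorizes
    tfae_have 2 → 3 := fun h => by
      obtain ⟨h₁, h₂⟩ := RelMajorizes.dmax_ge b hw hxy hσ hσ_supp h
      obtain ⟨q₁, q₂, q₃⟩ := hQ _ rfl
      refine ⟨h₁, h₂, (dmin_ge_dmin (trace_suppProj_mul_re_nonneg b hσ.posSemidef.nonneg)).mpr ?_⟩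
      exact RelMajorizes.trace_le q₁ q₂ hg.ne' q₃ hρ.posSemidef.nonneg h
    tfae_have 3 → 1 := fun ⟨h₁, h₂, h₃⟩ => by
      -- The cases record which of `x` and `y` are ground levels; a single one may be taken to be
      -- the first label by symmetry.
      rcases hw' x with hx | hx <;> rcases hw' y with hy | hy
      · exact convertible_of_zero b hxy hρ hσ hρ_supp hσ_supp hx hy
      · have hc : compress (b x) (b y) (diagonalIn b w) = compress (b y) (b x) (diagonalIn b w) := by
          rw [compress, compress, add_comm]
        rw [hc] at h₂
        rw [Set.pair_comm] at hρ_supp hσ_supp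
        exact convertible_of_pos_of_zero b hxy.symm hρ hσ hρ_supp hσ_supp hy hx h₂ h₃
      · exact convertible_of_pos_of_zero b hxy hρ hσ hρ_supp hσ_supp hx hy h₂ h₃
      · exact convertible_of_pos b hw hxy hρ hσ hρ_supp hσ_supp hx hy h₁ h₂
    tfae_finish
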